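/- **Setting.** Let $\ell,n\in\mathbb N$, $0=\tau_0<\tau_1<\dots<\tau_\ell=\Delta$. $|\cdot|$ is the maximum norm. $\mathcal L^\infty$ is the set of essentially bounded Lebesgue measurable functions $[-\Delta,0]\to\mathbb R^n$, $L^\infty$ the corresponding space of classes modulo a.e. equality, with the essential supremum norm $\|\cdot\|$; $B_R^m$ and $B_R^{L^\infty}$ are the closed balls of radius $R$ about $0$ in $\mathbb R^m$ and $L^\infty$. Write $\phi^k\rightharpoonup\phi^0$ (weak-* convergence in $L^\infty$) if $\int_{-\Delta}^0 g(s)^T\phi^k(s)\,ds\to\int_{-\Delta}^0 g(s)^T\phi^0(s)\,ds$ for every $g\in L^1([-\Delta,0],\mathbb R^n)$. For $\phi$ on $[-\Delta,0]$ and $x$ on an interval starting at $t_0$, let $(\phi\diamond_{t_0}x)(t)=\phi(t-t_0)$ for $t_0-\Delta\le t<t_0$ and $(\phi\diamond_{t_0}x)(t)=x(t)$ for $t\ge t_0$. For a function $\mathsf x$ put $\mathsf x_t(s)=\mathsf x(t+s)$, $s\in[-\Delta,0]$, and $\mathsf x(t-\tau_{0:\ell})=(\mathsf x(t-\tau_0),\dots,\mathsf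 x(t-\tau_\ell))$. For $f:\mathbb R_{\ge0}\times\mathbb R^{(\ell+1)n}\times L^\infty\to\mathbb R^n$, $t_0\ge0$, $\xi\in\mathbb R^n$ and $\phi\in L^\infty$, consider $$\dot x(t)=f(t,\mathsf x(t-\tau_{0:\ell}),\mathsf x_t),\qquad \mathsf x=\phi\diamond_{t_0}x,\qquad x(t_0)=\xi .\tag{1}$$ A solution on $J=[t_0,b)$ or $J=[t_0,b]$, $t_0<b\le\infty$, is a locally absolutely continuous $x:J\to\mathbb R^n$ with $x(t)=\xi+\int_{t_0}^t f(s,\mathsf x(s-\tau_{0:\ell}),\mathsf x_s)\,ds$ for all $t\in J$, where any bounded representative of $\phi$ is used in $\mathsf x$; it is maximally defined if no solution from the same $(\xi,\phi)$ at $t_0$ strictly extends it. Let $x(\cdot\,;t_0,\xi,\phi,f)$ denote the (unique) maximally defined solution and $[t_0,T_{(t_0,\xi,\phi,f)})$ its interval of definition. **Assumption on a family.** Let $\mathcal F$ be a set of such functions $f$ satisfying the following. (A) (i) For every $R,T>0$ there is $L\ge0$ such that for every $f\in\mathcal F$ there is a null set $Z$ with $|f(t,\xi_{0:\ell},\phi)-f(t,\zeta_{0:\ell},\psi)|\le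 L\max\{|\xi_{0:\ell}-\zeta_{0:\ell}|,\|\phi-\psi\|\}$ for all $t\in[0,T]\setminus Z$, $\xi_{0:\ell},\zeta_{0:\ell}\in B_R^{(\ell+1)n}$, $\phi,\psi\in B_R^{L^\infty}$. (ii) For every $T>0$ there is $M$ such that for every $f\in\mathcal F$, $|f(t,0,0)|\le M$ for a.e. $t\in[0,T]$. (iii) For all $f\in\mathcal F$, $0\le t_0<T$, $\phi\in\mathcal L^\infty$ and continuous $x:[t_0,T]\to\mathbb R^n$, the function $t\mapsto f(t,\mathsf x(t-\tau_{0:\ell}),\mathsf x_t)$, $\mathsf x=\phi\diamond_{t_0}x$, is Lebesgue measurable on $[t_0,T]$. (B) For every $T,R>0$ there are null sets $Z_f$ ($f\in\mathcal F$) such that for every $\varepsilon>0$ and every sequence $\{\phi^k\}\subset B_R^{L^\infty}$ with $\phi^k\rightharpoonup\phi^0$ there is $j\in\mathbb N$ with $|f(t,\xi_{0:\ell},\phi^k)-f(t,\xi_{0:\ell},\phi^0)|<\varepsilon$ for all $f\in\mathcal F$, $t\in[0,T]\setminus Z_f$, $\xi_{0:\ell}\in B_R^{(\ell+1)n}$,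 $k\ge j$. (C) For every $t_0\ge0$, $R\ge0$, continuous $x:[t_0,t_0+\Delta]\to B_R^n$, sequence $\{\phi^k\}\subset B_R^{L^\infty}$ with $\phi^k\rightharpoonup\phi^0$, and $\varepsilon>0$ there is $j\in\mathbb N$ such that for all $t\in[t_0,t_0+\Delta]$, $k\ge j$ and $f\in\mathcal F$ the following integral exists and $$\left|\int_{t_0}^t\big[f(s,\mathsf x^k(s-\tau_{0:\ell}),\mathsf x^0_s)-f(s,\mathsf x^0(s-\tau_{0:\ell}),\mathsf x^0_s)\big]ds\right|<\varepsilon,\qquad \mathsf x^k=\phi^k\diamond_{t_0}x .$$ **Proposition.** Let $\mathcal F$ satisfy (A), (B), (C). Let $t_0\ge0$, $\xi^0\in\mathbb R^n$, $\phi^0\in L^\infty$, and let $T>t_0$ satisfy $T<T_{(t_0,\xi^0,\phi^0,f)}$ for every $f\in\mathcal F$. Let $\xi^k\to\xi^0$ in $\mathbb R^n$ and $\phi^k\rightharpoonup\phi^0$ in $L^\infty$. If $$\sup_{f\in\mathcal F}\ \sup_{t_0\le t\le T}|x(t;t_0,\xi^0,\phi^0,f)|<\infty,$$ then for every $\varepsilon>0$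 there is $j\in\mathbb N$ such that for all $k\ge j$ and all $f\in\mathcal F$ the maximally defined solution from $(\xi^k,\phi^k)$ exists, is defined on $[t_0,T]$ (that is, $T<T_{(t_0,\xi^k,\phi^k,f)}$), and $$\sup_{t_0\le s\le T}|x(s;t_0,\xi^k,\phi^k,f)-x(s;t_0,\xi^0,\phi^0,f)|\le\varepsilon .$$ -/

import Mathlib

open MeasureTheory Filter Topology Set
open scoped ENNReal

noncomputable section

/-- Lebesgue measure on the delay interval `[-Δ, 0]`. -/
abbrev delayMeasure (Δ : ℝ) : Measure ℝ := volume.restrict (Icc (-Δ) 0)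

/-- `L^∞([-Δ, 0], ℝⁿ)`; the norm of `Fin n → ℝ` is the maximum norm, and the norm of this space is
the essential supremum of the maximum norm. -/
abbrev LInf (Δ : ℝ) (n : ℕ) : Type := Lp (Fin n → ℝ) ∞ (delayMeasure Δ)

/-- Right-hand sides `f(t, (ξ₀, …, ξ_ℓ), φ)`. Only the values at times `t ≥ 0` are ever used. -/
abbrev RHS (ℓ n : ℕ) (Δ : ℝ) : Type :=
  ℝ → (Fin (ℓ + 1) → Fin n → ℝ) → LInf Δ n → (Fin n → ℝ)

/-- The class in `L^∞([-Δ, 0], ℝⁿ)` of an essentially bounded measurable function on `[-Δ, 0]`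
(and `0` for every other function). -/
def toLInf (Δ : ℝ) {n : ℕ} (g : ℝ → Fin n → ℝ) : LInf Δ n :=
  open Classical in
  if h : MemLp g ∞ (delayMeasure Δ) then h.toLp g else 0

/-- The concatenation at time `t₀` of an initial function `φ` on `[-Δ, 0]` and a function `x`
on an interval starting at `t₀`. -/
def conc (t₀ : ℝ) {n : ℕ} (φ x : ℝ → Fin n → ℝ) : ℝ → Fin n → ℝ :=
  fun t => if t < t₀ then φ (t - t₀) else x t

/-- The values `(z(t - τ₀), …, z(t - τ_ℓ))`. -/
def delayed {ℓ n : ℕ} (τ : Fin (ℓ + 1) → ℝ) (z : ℝ → Fin n → ℝ) (t : ℝ) :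
    Fin (ℓ + 1) → Fin n → ℝ :=
  fun i => z (t - τ i)

/-- The segment `z_t`, that is `s ↦ z(t + s)` on `[-Δ, 0]`, as an element of `L^∞`. -/
def delaySegment (Δ : ℝ) {n : ℕ} (z : ℝ → Fin n → ℝ) (t : ℝ) : LInf Δ n :=
  toLInf Δ (fun s => z (t + s))

/-- The segments that occur below are essentially bounded and measurable, so the default value in
`toLInf` plays no role. -/
theorem memLp_segment {Δ : ℝ} {n : ℕ} {t₀ t : ℝ} (ht : t₀ ≤ t) {φ x : ℝ → Fin n → ℝ}
    (hφ : MemLp φ ∞ (delayMeasure Δ)) (hx : ContinuousOn x (Icc t₀ t)) :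
    MemLp (fun s => conc t₀ φ x (t + s)) ∞ (delayMeasure Δ) := by
  have hA : MeasurableSet {s : ℝ | t + s < t₀} := measurableSet_lt (by fun_prop) (by fun_prop)
  have h1 : MemLp (fun s => φ (t + s - t₀)) ∞
      ((delayMeasure Δ).restrict {s : ℝ | t + s < t₀}) := by
    have hmp : MeasurePreserving (fun s : ℝ => s + (t - t₀)) volume volume :=
      measurePreserving_add_right volume (t - t₀)
    have h := hφ.comp_measurePreserving
      (hmp.restrict_preimage (s := Icc (-Δ) 0) measurableSet_Icc)
    have he : (fun s => φ (t + s - t₀)) = φ ∘ fun s : ℝ => s + (t - t₀) := by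
      funext s; simp only [Function.comp]; congr 1; ring
    rw [he]
    refine h.mono_measure ?_
    rw [delayMeasure, Measure.restrict_restrict hA]
    refine Measure.restrict_mono ?_ le_rfl
    rintro s ⟨hs1, hs2, hs3⟩
    simp only [mem_ofPred_eq, mem_preimage, mem_Icc] at *
    constructor <;> linarith
  have h2 : MemLp (fun s => x (t + s)) ∞
      ((delayMeasure Δ).restrict {s : ℝ | t + s < t₀}ᶜ) := by
    have hc : ContinuousOn (fun s => x (t + s)) (Icc (t₀ - t) 0) := by
      refine hx.comp (by fun_prop) ?_
      rintro s ⟨hs1, hs2⟩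
      simp only [mem_Icc]
      constructor <;> linarith
    obtain ⟨C, hC⟩ := isCompact_Icc.exists_bound_of_continuousOn hc
    have h : MemLp (fun s => x (t + s)) ∞ (volume.restrict (Icc (t₀ - t) 0)) :=
      memLp_top_of_bound (hc.aestronglyMeasurable measurableSet_Icc) C
        ((ae_restrict_iff' measurableSet_Icc).2 (Eventually.of_forall hC))
    refine h.mono_measure ?_
    rw [delayMeasure, Measure.restrict_restrict hA.compl]
    refine Measure.restrict_mono ?_ le_rfl
    rintro s ⟨hs1, hs2, hs3⟩
    simp only [mem_compl_iff, mem_ofPred_eq, not_lt, mem_Icc] at *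
    constructor <;> linarith
  classical
  exact (MemLp.piecewise hA h1 h2).ae_eq (Eventually.of_forall fun s => rfl)

/-- `φᵏ ⇀ φ⁰` weakly-* in `L^∞`: convergence of `∫ g(s)ᵀ φᵏ(s) ds` for every `g ∈ L¹`. -/
def WeakStarTendsto {Δ : ℝ} {n : ℕ} (φ : ℕ → LInf Δ n) (φ₀ : LInf Δ n) : Prop :=
  ∀ g : ℝ → Fin n → ℝ, Integrable g (delayMeasure Δ) →
    Tendsto (fun k => ∫ s, g s ⬝ᵥ φ k s ∂(delayMeasure Δ)) atTop
      (𝓝 (∫ s, g s ⬝ᵥ φ₀ s ∂(delayMeasure Δ)))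

/-- The standing regularity assumption on the right-hand sides, uniformly over a family `F`:
a common local Lipschitz constant `L(R, T)` outside null sets that may depend on the member of the
family, a common local essential bound of `f(·, 0, 0)`, and measurability along
concatenations of essentially bounded initial functions with continuous functions. -/
structure UniformlyLipschitz {ℓ n : ℕ} {Δ : ℝ} (τ : Fin (ℓ + 1) → ℝ) (F : Set (RHS ℓ n Δ)) :
    Prop where
  lipschitz : ∀ R > 0, ∀ T > 0, ∃ L : ℝ, 0 ≤ L ∧ ∀ f ∈ F, ∃ Z : Set ℝ, volume Z = 0 ∧
    ∀ t ∈ Icc 0 T \ Z, ∀ ξ ζ : Fin (ℓ + 1) → Fin n → ℝ, ‖ξ‖ ≤ R → ‖ζ‖ ≤ R →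
      ∀ φ ψ : LInf Δ n, ‖φ‖ ≤ R → ‖ψ‖ ≤ R →
        ‖f t ξ φ - f t ζ ψ‖ ≤ L * max ‖ξ - ζ‖ ‖φ - ψ‖
  bounded : ∀ T > 0, ∃ M : ℝ, ∀ f ∈ F, ∀ᵐ t ∂(volume.restrict (Icc 0 T)), ‖f t 0 0‖ ≤ M
  measurable : ∀ f ∈ F, ∀ t₀ ≥ 0, ∀ T > t₀, ∀ φ x : ℝ → Fin n → ℝ,
    MemLp φ ∞ (delayMeasure Δ) → ContinuousOn x (Icc t₀ T) →
      AEMeasurable (fun t => f t (delayed τ (conc t₀ φ x) t) (delaySegment Δ (conc t₀ φ x) t))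
        (volume.restrict (Icc t₀ T))

/-- The assumption on a family of right-hand sides under which solutions depend continuously on
weakly-* convergent initial functions.

In `weakStar` the exceptional null set may depend on `f` (and on the bounds `T` and `R`), but
neither on the sequence `φᵏ` nor on `ε`. In `discrete`, the integral is understood to exist. -/
structure WeakStarRegular {ℓ n : ℕ} {Δ : ℝ} (τ : Fin (ℓ + 1) → ℝ) (F : Set (RHS ℓ n Δ)) :
    Prop where
  lip : UniformlyLipschitz τ F
  weakStar : ∀ T > 0, ∀ R > 0, ∃ Z : RHS ℓ n Δ → Set ℝ, (∀ f ∈ F, volume (Z f) = 0) ∧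
    ∀ ε > 0, ∀ (φ : ℕ → LInf Δ n) (φ₀ : LInf Δ n), (∀ k, ‖φ k‖ ≤ R) → WeakStarTendsto φ φ₀ →
      ∃ j : ℕ, ∀ f ∈ F, ∀ t ∈ Icc 0 T \ Z f, ∀ ξ : Fin (ℓ + 1) → Fin n → ℝ, ‖ξ‖ ≤ R →
        ∀ k ≥ j, ‖f t ξ (φ k) - f t ξ φ₀‖ < ε
  discrete : ∀ t₀ ≥ 0, ∀ R ≥ 0, ∀ x : ℝ → Fin n → ℝ, ContinuousOn x (Icc t₀ (t₀ + Δ)) →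
    (∀ t ∈ Icc t₀ (t₀ + Δ), ‖x t‖ ≤ R) →
    ∀ (φ : ℕ → LInf Δ n) (φ₀ : LInf Δ n), (∀ k, ‖φ k‖ ≤ R) → WeakStarTendsto φ φ₀ →
    ∀ ε > 0, ∃ j : ℕ, ∀ t ∈ Icc t₀ (t₀ + Δ), ∀ k ≥ j, ∀ f ∈ F,
      IntervalIntegrable (fun s =>
          f s (delayed τ (conc t₀ (φ k) x) s) (delaySegment Δ (conc t₀ φ₀ x) s)
            - f s (delayed τ (conc t₀ φ₀ x) s) (delaySegment Δ (conc t₀ φ₀ x) s)) volume t₀ t ∧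
      ‖∫ s in t₀..t,
          (f s (delayed τ (conc t₀ (φ k) x) s) (delaySegment Δ (conc t₀ φ₀ x) s)
            - f s (delayed τ (conc t₀ φ₀ x) s) (delaySegment Δ (conc t₀ φ₀ x) s))‖ < ε

/-- `x : J → ℝⁿ` solves `ẋ(t) = f(t, z(t - τ₀), …, z(t - τ_ℓ), z_t)`, where `z` is the
concatenation of `φ` and `x` at `t₀`, with the pointwise defined initial function `φ`: it is
locally absolutely continuous on `J` and satisfies the integral equation there. Here
`J = [t₀, b)` or `J = [t₀, b]` with `t₀ < b ≤ ∞`; values of `x` outside `J` are not used. -/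
structure IsSolution {ℓ n : ℕ} {Δ : ℝ} (τ : Fin (ℓ + 1) → ℝ) (f : RHS ℓ n Δ) (t₀ : ℝ)
    (φ : ℝ → Fin n → ℝ) (x : ℝ → Fin n → ℝ) (J : Set ℝ) : Prop where
  interval : ∃ b : EReal, (t₀ : EReal) < b ∧
    (J = {t : ℝ | t₀ ≤ t ∧ (t : EReal) < b} ∨ J = {t : ℝ | t₀ ≤ t ∧ (t : EReal) ≤ b})
  absCont : ∀ t ∈ J, AbsolutelyContinuousOnInterval x t₀ t
  integrable : ∀ t ∈ J, IntervalIntegrable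
    (fun s => f s (delayed τ (conc t₀ φ x) s) (delaySegment Δ (conc t₀ φ x) s)) volume t₀ t
  eqn : ∀ t ∈ J, x t = φ 0 +
    ∫ s in t₀..t, f s (delayed τ (conc t₀ φ x) s) (delaySegment Δ (conc t₀ φ x) s)

/-- `x : [t₀, Tₓ) → ℝⁿ` is a maximally defined solution with initial function `φ`: it is a
solution, and no solution with the same initial function is a strict extension of it. -/
structure IsMaximalSolution {ℓ n : ℕ} {Δ : ℝ} (τ : Fin (ℓ + 1) → ℝ) (f : RHS ℓ n Δ) (t₀ : ℝ)
    (φ : ℝ → Fin n → ℝ) (x : ℝ → Fin n → ℝ) (Tₓ : EReal) : Prop where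
  isSolution : IsSolution τ f t₀ φ x {t : ℝ | t₀ ≤ t ∧ (t : EReal) < Tₓ}
  maximal : ∀ (y : ℝ → Fin n → ℝ) (J : Set ℝ), IsSolution τ f t₀ φ y J →
    {t : ℝ | t₀ ≤ t ∧ (t : EReal) < Tₓ} ⊆ J →
    EqOn y x {t : ℝ | t₀ ≤ t ∧ (t : EReal) < Tₓ} → J = {t : ℝ | t₀ ≤ t ∧ (t : EReal) < Tₓ}

/-- `x : [t₀, Tₓ) → ℝⁿ` is a maximally defined solution with `x(t₀) = ξ` and history
`φ ∈ L^∞`: it is a maximally defined solution for a bounded representative `ψ` of `φ` with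
`ψ(0) = ξ`. (The integral equation does not change with the representative.) -/
def IsMaximalSolutionFrom {ℓ n : ℕ} {Δ : ℝ} (τ : Fin (ℓ + 1) → ℝ) (f : RHS ℓ n Δ) (t₀ : ℝ)
    (ξ : Fin n → ℝ) (φ : LInf Δ n) (x : ℝ → Fin n → ℝ) (Tₓ : EReal) : Prop :=
  ∃ ψ : ℝ → Fin n → ℝ, (∃ C : ℝ, ∀ s ∈ Icc (-Δ) 0, ‖ψ s‖ ≤ C) ∧
    ψ =ᵐ[delayMeasure Δ] φ ∧ ψ 0 = ξ ∧ IsMaximalSolution τ f t₀ ψ x Tₓ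

end

/-! ### Segments and delayed values -/

/-! Write `x` for the perturbed and `y` for the reference solution of the same `f`. Their difference
is the initial error, plus the integral of the change caused by replacing `y` by `x` under the
history `φᵏ`, plus the integral of the change caused by replacing `φ⁰` by `φᵏ` along `y`. Assumption
(A) makes the second term a Gronwall term, so everything rests on making the third small uniformly
in `f` and `t`.

The history acts in two ways, which `rhsAlong` separates. Through the segment its effect is
pointwise small by (B), but (B) concerns one weak-* convergent sequence while segments vary with
time and with `f`. Through the delayed values it need not be pointwise small, since `φᵏ` may
oscillate; (C) bounds only the integral, and for one fixed `y`. Compactness closes both gaps: by (A)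
the uniformly bounded reference solutions are equi-Lipschitz, so sequences of them subconverge
uniformly (Arzelà–Ascoli). Segments converge weak-* jointly in time, history and function
(`WeakStarTendsto.delaySegment`), because translation is continuous in L¹; this settles (B) by
contradiction. For (C) one passes to the uniform limit and pays a Lipschitz error.

The result, `WeakStarRegular.exists_forall_rhsAlong_decomposition`, writes the third integrand as a
term `D` with small integral plus a remainder that is small almost everywhere, which is what
`norm_sub_lt_exp_of_decomposition` needs. The estimate holds while `x` exists and keeps `x` bounded,
hence `x` cannot stop before `T` (`IsMaximalSolution.lt_of_forall_norm_le`). Weak-* convergent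
sequences are bounded by Banach–Steinhaus, so one radius `R` serves throughout. -/

theorem ae_shift_of_ae_delayMeasure {Δ : ℝ} {P : ℝ → Prop} (h : ∀ᵐ r ∂(delayMeasure Δ), P r)
    (c : ℝ) : ∀ᵐ s : ℝ, s + c ∈ Icc (-Δ) 0 → P (s + c) :=
  (measurePreserving_add_right volume c).quasiMeasurePreserving.ae
    ((ae_restrict_iff' measurableSet_Icc).1 h)

theorem norm_LInf_le {Δ : ℝ} {n : ℕ} {φ : LInf Δ n} {C : ℝ} (hC : 0 ≤ C)
    (h : ∀ᵐ s ∂(delayMeasure Δ), ‖φ s‖ ≤ C) : ‖φ‖ ≤ C := by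
  simpa using Lp.norm_le_of_ae_bound hC h

theorem LInf_ae_norm_le {Δ : ℝ} {n : ℕ} (φ : LInf Δ n) :
    ∀ᵐ s ∂(delayMeasure Δ), ‖φ s‖ ≤ ‖φ‖ := by
  filter_upwards [ae_le_eLpNormEssSup (f := φ) (μ := delayMeasure Δ)] with s hs
  have h := Lp.eLpNorm_ne_top φ
  rw [eLpNorm_exponent_top] at h
  rw [Lp.norm_def, eLpNorm_exponent_top, ← toReal_enorm]
  exact ENNReal.toReal_mono h hs

section Segments

variable {Δ t₀ t : ℝ} {n : ℕ} {φ ψ x y : ℝ → Fin n → ℝ}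

theorem delaySegment_conc_ae_eq (ht : t₀ ≤ t) (hφ : MemLp φ ∞ (delayMeasure Δ))
    (hx : ContinuousOn x (Icc t₀ t)) :
    delaySegment Δ (conc t₀ φ x) t =ᵐ[delayMeasure Δ] fun s => conc t₀ φ x (t + s) := by
  have h := memLp_segment ht hφ hx
  rw [delaySegment, toLInf, dif_pos h]
  exact h.coeFn_toLp

theorem norm_delaySegment_conc_le (ht : t₀ ≤ t) (hφ : MemLp φ ∞ (delayMeasure Δ))
    (hx : ContinuousOn x (Icc t₀ t)) {R : ℝ} (hφR : ∀ᵐ r ∂(delayMeasure Δ), ‖φ r‖ ≤ R)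
    (hxR : ∀ s ∈ Icc t₀ t, ‖x s‖ ≤ R) : ‖delaySegment Δ (conc t₀ φ x) t‖ ≤ R := by
  refine norm_LInf_le ((norm_nonneg _).trans (hxR t₀ ⟨le_rfl, ht⟩)) ?_
  filter_upwards [delaySegment_conc_ae_eq ht hφ hx,
    ae_restrict_of_ae (s := Icc (-Δ) 0) (ae_shift_of_ae_delayMeasure hφR (t - t₀)),
    ae_restrict_mem measurableSet_Icc] with s hs h1 h2
  rw [hs, conc]
  split_ifs with h
  · have := h1 ⟨by linarith [h2.1], by linarith⟩
    rwa [show s + (t - t₀) = t + s - t₀ by ring] at this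
  · exact hxR _ ⟨not_lt.1 h, by linarith [h2.2]⟩

theorem norm_delaySegment_conc_sub_le (ht : t₀ ≤ t) (hφ : MemLp φ ∞ (delayMeasure Δ))
    (hx : ContinuousOn x (Icc t₀ t)) (hy : ContinuousOn y (Icc t₀ t)) {c : ℝ}
    (hc : ∀ s ∈ Icc t₀ t, ‖x s - y s‖ ≤ c) :
    ‖delaySegment Δ (conc t₀ φ x) t - delaySegment Δ (conc t₀ φ y) t‖ ≤ c := by
  have hc0 : 0 ≤ c := (norm_nonneg _).trans (hc t₀ ⟨le_rfl, ht⟩)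
  refine norm_LInf_le hc0 ?_
  filter_upwards [delaySegment_conc_ae_eq ht hφ hx, delaySegment_conc_ae_eq ht hφ hy,
    Lp.coeFn_sub (delaySegment Δ (conc t₀ φ x) t) (delaySegment Δ (conc t₀ φ y) t),
    ae_restrict_mem measurableSet_Icc] with s h1 h2 h3 h4
  rw [h3, Pi.sub_apply, h1, h2, conc, conc]
  split_ifs with h
  · simpa using hc0
  · exact hc _ ⟨not_lt.1 h, by linarith [h4.2]⟩

theorem delaySegment_conc_congr_ae (ht : t₀ ≤ t) (hφ : MemLp φ ∞ (delayMeasure Δ))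
    (hψ : ψ =ᵐ[delayMeasure Δ] φ) (hx : ContinuousOn x (Icc t₀ t)) :
    delaySegment Δ (conc t₀ ψ x) t = delaySegment Δ (conc t₀ φ x) t := by
  apply Lp.ext
  filter_upwards [delaySegment_conc_ae_eq ht hφ hx,
    delaySegment_conc_ae_eq ht ((memLp_congr_ae hψ).2 hφ) hx,
    ae_restrict_of_ae (s := Icc (-Δ) 0) (ae_shift_of_ae_delayMeasure hψ (t - t₀)),
    ae_restrict_mem measurableSet_Icc] with s h1 h2 h3 h4
  rw [h1, h2, conc, conc]
  split_ifs with h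
  · have := h3 ⟨by linarith [h4.1], by linarith⟩
    rwa [show s + (t - t₀) = t + s - t₀ by ring] at this
  · rfl

variable {ℓ : ℕ} {τ : Fin (ℓ + 1) → ℝ}

theorem norm_delayed_conc_sub_le (hτ : ∀ i, τ i ∈ Icc 0 Δ) (ht : t₀ ≤ t) {c : ℝ}
    (hc : ∀ s ∈ Icc t₀ t, ‖x s - y s‖ ≤ c) :
    ‖delayed τ (conc t₀ φ x) t - delayed τ (conc t₀ φ y) t‖ ≤ c := by
  have hc0 : 0 ≤ c := (norm_nonneg _).trans (hc t₀ ⟨le_rfl, ht⟩)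
  refine (pi_norm_le_iff_of_nonneg hc0).2 fun i => ?_
  simp only [Pi.sub_apply, delayed, conc]
  split_ifs with h
  · simpa using hc0
  · exact hc _ ⟨not_lt.1 h, by linarith [(hτ i).1]⟩

/-- Delayed values evaluate `φ` pointwise, yet null sets of `φ` are harmless: there are finitely
many delays, and translates of null sets are null. -/
theorem ae_delayed_history {P : ℝ → Prop} (hτ : ∀ i, τ i ∈ Icc 0 Δ)
    (h : ∀ᵐ r ∂(delayMeasure Δ), P r) (t₀ : ℝ) :
    ∀ᵐ s : ℝ, t₀ ≤ s → ∀ i, s - τ i < t₀ → P (s - τ i - t₀) := by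
  have : ∀ᵐ s : ℝ, ∀ i, s + (-τ i - t₀) ∈ Icc (-Δ) 0 → P (s + (-τ i - t₀)) :=
    ae_all_iff.2 fun i => ae_shift_of_ae_delayMeasure h _
  filter_upwards [this] with s hs h0 i hi
  have := hs i ⟨by linarith [(hτ i).2], by linarith⟩
  rwa [show s + (-τ i - t₀) = s - τ i - t₀ by ring] at this

theorem ae_norm_delayed_conc_le (hτ : ∀ i, τ i ∈ Icc 0 Δ) {R : ℝ}
    (hφR : ∀ᵐ r ∂(delayMeasure Δ), ‖φ r‖ ≤ R) (hxR : ∀ s ∈ Icc t₀ t, ‖x s‖ ≤ R) :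
    ∀ᵐ s : ℝ, s ∈ Icc t₀ t → ‖delayed τ (conc t₀ φ x) s‖ ≤ R := by
  filter_upwards [ae_delayed_history hτ hφR t₀] with s hs hst
  have hR : 0 ≤ R := (norm_nonneg _).trans (hxR s hst)
  refine (pi_norm_le_iff_of_nonneg hR).2 fun i => ?_
  simp only [delayed, conc]
  split_ifs with h
  · exact hs hst.1 i h
  · exact hxR _ ⟨not_lt.1 h, by linarith [(hτ i).1, hst.2]⟩

theorem ae_delayed_conc_congr (hτ : ∀ i, τ i ∈ Icc 0 Δ) (hψ : ψ =ᵐ[delayMeasure Δ] φ) (t₀ : ℝ)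
    (x : ℝ → Fin n → ℝ) :
    ∀ᵐ s : ℝ, t₀ ≤ s → delayed τ (conc t₀ ψ x) s = delayed τ (conc t₀ φ x) s := by
  filter_upwards [ae_delayed_history hτ hψ t₀] with s hs hst
  funext i
  simp only [delayed, conc]
  split_ifs with h
  · exact hs hst i h
  · rfl

end Segments

/-! ### The right-hand side along a function -/

/-- The right-hand side along `x`, where the initial function enters the delayed values through
`φ` and the segment through `χ`. -/
noncomputable def rhsAlong {ℓ n : ℕ} {Δ : ℝ} (τ : Fin (ℓ + 1) → ℝ) (f : RHS ℓ n Δ) (t₀ : ℝ)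
    (φ χ x : ℝ → Fin n → ℝ) (s : ℝ) : Fin n → ℝ :=
  f s (delayed τ (conc t₀ φ x) s) (delaySegment Δ (conc t₀ χ x) s)

section RightHandSide

variable {ℓ n : ℕ} {Δ : ℝ} {τ : Fin (ℓ + 1) → ℝ} {F : Set (RHS ℓ n Δ)} {f : RHS ℓ n Δ}
  {t₀ : ℝ} {φ ψ χ x y : ℝ → Fin n → ℝ}

theorem rhsAlong_congr (hτ : ∀ i, τ i ∈ Icc 0 Δ) {t : ℝ} (ht : t₀ ≤ t)
    (hχ : MemLp χ ∞ (delayMeasure Δ))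
    (hx : ContinuousOn x (Icc t₀ t)) (h : ∀ s ∈ Icc t₀ t, x s = y s) :
    rhsAlong τ f t₀ φ χ x t = rhsAlong τ f t₀ φ χ y t := by
  have hy : ContinuousOn y (Icc t₀ t) := hx.congr fun s hs => (h s hs).symm
  have h0 : ∀ s ∈ Icc t₀ t, ‖x s - y s‖ ≤ 0 := fun s hs => by simp [h s hs]
  have h1 := norm_le_zero_iff.1 (norm_delayed_conc_sub_le (φ := φ) hτ ht h0)
  have h2 := norm_le_zero_iff.1 (norm_delaySegment_conc_sub_le ht hχ hx hy h0)
  rw [rhsAlong, rhsAlong, sub_eq_zero.1 h1, sub_eq_zero.1 h2]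

theorem rhsAlong_congr_history (hτ : ∀ i, τ i ∈ Icc 0 Δ) (hφ : MemLp φ ∞ (delayMeasure Δ))
    (hψ : ψ =ᵐ[delayMeasure Δ] φ) {b : ℝ} (hx : ContinuousOn x (Icc t₀ b)) :
    ∀ᵐ s : ℝ, s ∈ Icc t₀ b → rhsAlong τ f t₀ ψ ψ x s = rhsAlong τ f t₀ φ φ x s := by
  filter_upwards [ae_delayed_conc_congr hτ hψ t₀ x] with s hs hsb
  rw [rhsAlong, rhsAlong, hs hsb.1, delaySegment_conc_congr_ae hsb.1 hφ hψ
    (hx.mono (Icc_subset_Icc_right hsb.2))]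

/-- Both constants are fixed before `f`, the histories and the functions, which is the source of all
uniformity over the family. The quantifier over `c` stands inside the almost-everywhere statement so
that `c` may later depend on `s`. -/
theorem exists_rhsAlong_bounds (hτ : ∀ i, τ i ∈ Icc 0 Δ) (hF : UniformlyLipschitz τ F)
    {R : ℝ} (hR : 0 < R) {T : ℝ} (hT : 0 < T) :
    ∃ K L : ℝ, 0 ≤ K ∧ 0 ≤ L ∧ ∀ f ∈ F, ∀ t₀ ≥ 0, ∀ b ≤ T, ∀ φ χ : ℝ → Fin n → ℝ,
      MemLp χ ∞ (delayMeasure Δ) → (∀ᵐ r ∂(delayMeasure Δ), ‖φ r‖ ≤ R) →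
      (∀ᵐ r ∂(delayMeasure Δ), ‖χ r‖ ≤ R) → ∀ x : ℝ → Fin n → ℝ, ContinuousOn x (Icc t₀ b) →
      (∀ s ∈ Icc t₀ b, ‖x s‖ ≤ R) →
      (∀ᵐ s : ℝ, s ∈ Icc t₀ b → ‖rhsAlong τ f t₀ φ χ x s‖ ≤ K) ∧
      ∀ y : ℝ → Fin n → ℝ, ContinuousOn y (Icc t₀ b) → (∀ s ∈ Icc t₀ b, ‖y s‖ ≤ R) →
        ∀ᵐ s : ℝ, s ∈ Icc t₀ b → ∀ c, (∀ r ∈ Icc t₀ s, ‖x r - y r‖ ≤ c) →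
          ‖rhsAlong τ f t₀ φ χ x s - rhsAlong τ f t₀ φ χ y s‖ ≤ L * c := by
  obtain ⟨L, hL, hlip⟩ := hF.lipschitz R hR T hT
  obtain ⟨M, hM⟩ := hF.bounded T hT
  -- The value at zero is bounded by `M`, and the arguments are within `R` of zero.
  refine ⟨|M| + L * R, L, by positivity, hL, ?_⟩
  intro f hf t₀ ht₀ b hb φ χ hχ hφR hχR x hx hxR
  obtain ⟨Z, hZ, hlipZ⟩ := hlip f hf
  have hZ' : ∀ᵐ s : ℝ, s ∉ Z := measure_eq_zero_iff_ae_notMem.1 hZ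
  constructor
  · filter_upwards [hZ', (ae_restrict_iff' measurableSet_Icc).1 (hM f hf),
      ae_norm_delayed_conc_le hτ hφR hxR] with s h1 h2 h3 hs
    have hsT : s ∈ Icc 0 T := ⟨ht₀.trans hs.1, hs.2.trans hb⟩
    have h4 := norm_delaySegment_conc_le hs.1 hχ (hx.mono (Icc_subset_Icc_right hs.2)) hχR
      fun r hr => hxR r ⟨hr.1, hr.2.trans hs.2⟩
    have h5 := hlipZ s ⟨hsT, h1⟩ _ 0 (h3 hs) (by simpa using hR.le) _ 0 h4 (by simpa using hR.le)
    rw [sub_zero, sub_zero] at h5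
    have h6 := h5.trans (mul_le_mul_of_nonneg_left (max_le (h3 hs) h4) hL)
    have h7 := norm_le_norm_add_norm_sub' (rhsAlong τ f t₀ φ χ x s) (f s 0 0)
    have h8 := (h2 hsT).trans (le_abs_self M)
    rw [rhsAlong] at h7 ⊢
    linarith
  · intro y hy hyR
    filter_upwards [hZ', ae_norm_delayed_conc_le hτ hφR hxR,
      ae_norm_delayed_conc_le hτ hφR hyR] with s h1 h2 h3 hs c hc
    have hx' := hx.mono (Icc_subset_Icc_right hs.2)
    have hy' := hy.mono (Icc_subset_Icc_right hs.2)
    refine (hlipZ s ⟨⟨ht₀.trans hs.1, hs.2.trans hb⟩, h1⟩ _ _ (h2 hs) (h3 hs) _ _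
      (norm_delaySegment_conc_le hs.1 hχ hx' hχR fun r hr => hxR r ⟨hr.1, hr.2.trans hs.2⟩)
      (norm_delaySegment_conc_le hs.1 hχ hy' hχR fun r hr => hyR r ⟨hr.1, hr.2.trans hs.2⟩)).trans
      (mul_le_mul_of_nonneg_left (max_le (norm_delayed_conc_sub_le hτ hs.1 hc)
        (norm_delaySegment_conc_sub_le hs.1 hχ hx' hy' hc)) hL)

theorem MeasureTheory.MemLp.exists_ae_norm_le {α E : Type*} [MeasurableSpace α]
    [NormedAddCommGroup E] {μ : Measure α} {g : α → E} (hg : MemLp g ∞ μ) :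
    ∃ C : ℝ, ∀ᵐ a ∂μ, ‖g a‖ ≤ C := by
  refine ⟨(eLpNorm g ∞ μ).toReal, ?_⟩
  filter_upwards [ae_le_eLpNormEssSup (f := g) (μ := μ)] with s hs
  have h := hg.eLpNorm_ne_top
  rw [eLpNorm_exponent_top] at h ⊢
  rw [← toReal_enorm]
  exact ENNReal.toReal_mono h hs

theorem exists_common_bound (hφ : MemLp φ ∞ (delayMeasure Δ)) {b : ℝ}
    (hx : ContinuousOn x (Icc t₀ b)) :
    ∃ R > 0, (∀ᵐ r ∂(delayMeasure Δ), ‖φ r‖ ≤ R) ∧ ∀ s ∈ Icc t₀ b, ‖x s‖ ≤ R := by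
  obtain ⟨C, hC⟩ := hφ.exists_ae_norm_le
  obtain ⟨D, hD⟩ := isCompact_Icc.exists_bound_of_continuousOn hx
  have h1 := le_max_left |C| |D|
  have h2 := le_max_right |C| |D|
  refine ⟨max |C| |D| + 1, by positivity, ?_, fun s hs => ?_⟩
  · filter_upwards [hC] with r hr
    linarith [le_abs_self C]
  · linarith [hD s hs, le_abs_self D]

theorem intervalIntegrable_rhsAlong (hτ : ∀ i, τ i ∈ Icc 0 Δ) (hF : UniformlyLipschitz τ F)
    (hf : f ∈ F) (ht₀ : 0 ≤ t₀) {b : ℝ} (hb : t₀ ≤ b) (hφ : MemLp φ ∞ (delayMeasure Δ))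
    (hx : ContinuousOn x (Icc t₀ b)) :
    IntervalIntegrable (rhsAlong τ f t₀ φ φ x) volume t₀ b := by
  rcases hb.eq_or_lt with rfl | hlt
  · exact IntervalIntegrable.refl
  obtain ⟨R, hR, hφR, hxR⟩ := exists_common_bound hφ hx
  obtain ⟨K, L, -, -, h⟩ := exists_rhsAlong_bounds hτ hF hR (T := b) (ht₀.trans_lt hlt)
  have hK := (h f hf t₀ ht₀ b le_rfl φ φ hφ hφR hφR x hx hxR).1
  rw [intervalIntegrable_iff_integrableOn_Icc_of_le hb]
  refine Integrable.of_bound (hF.measurable f hf t₀ ht₀ b hlt φ x hφ hx).aestronglyMeasurable K ?_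
  exact (ae_restrict_iff' measurableSet_Icc).2 hK

end RightHandSide

/-! ### A comparison principle -/

/-- Continuous induction: at a first time with `v t ≤ ‖e t‖` the strict bound holds before, hence by
closure the weak bound holds up to and including that time, and `h` gives a contradiction. It also
allows bounds on a solution to be used only as long as they are already known. -/
theorem forall_norm_lt_of_forall_norm_le {E : Type*} [NormedAddCommGroup E] {e : ℝ → E}
    {v : ℝ → ℝ} {t₀ b : ℝ} (he : ContinuousOn e (Icc t₀ b)) (hv : ContinuousOn v (Icc t₀ b))
    (h0 : ‖e t₀‖ < v t₀)
    (h : ∀ t ∈ Icc t₀ b, (∀ s ∈ Icc t₀ t, ‖e s‖ ≤ v s) → ‖e t‖ < v t) :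
    ∀ t ∈ Icc t₀ b, ‖e t‖ < v t := by
  by_contra! hcon
  set A : Set ℝ := {t ∈ Icc t₀ b | v t ≤ ‖e t‖} with hA
  have hAc : IsCompact A :=
    isCompact_Icc.of_isClosed_subset
      (isClosed_Icc.isClosed_le hv he.norm) (sep_subset _ _)
  obtain ⟨t, htA, htmin⟩ := hAc.exists_isLeast (by obtain ⟨t, ht, h'⟩ := hcon; exact ⟨t, ht, h'⟩)
  refine (h t htA.1 fun s hs => ?_).not_ge htA.2
  have hlt : ∀ r ∈ Ico t₀ t, ‖e r‖ < v r := fun r hr => by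
    by_contra! hr'
    exact (htmin ⟨⟨hr.1, hr.2.le.trans htA.1.2⟩, hr'⟩).not_gt hr.2
  rcases htA.1.1.eq_or_lt with h1 | h1
  · obtain rfl : s = t₀ := le_antisymm (h1 ▸ hs.2) hs.1
    exact h0.le
  · have hsub : Icc t₀ t ⊆ Icc t₀ b := Icc_subset_Icc_right htA.1.2
    have hcl : IsClosed {s ∈ Icc t₀ t | ‖e s‖ ≤ v s} :=
      isClosed_Icc.isClosed_le (he.mono hsub).norm (hv.mono hsub)
    have : closure (Ico t₀ t) ⊆ {s ∈ Icc t₀ t | ‖e s‖ ≤ v s} :=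
      closure_minimal (fun r hr => ⟨⟨hr.1, hr.2.le⟩, (hlt r hr).le⟩) hcl
    rw [closure_Ico h1.ne] at this
    exact (this hs).2

/-- The exponential weight times `L` is at most the derivative of the weight, so it integrates to at
most its increment. The surplus `-η` later absorbs the other errors and yields strictness. -/
theorem norm_integral_le_exp_sub {E : Type*} [NormedAddCommGroup E] [NormedSpace ℝ E]
    {g : ℝ → E} {t₀ t L η δ : ℝ} (ht : t₀ ≤ t) (hη : 0 ≤ η)
    (hg : ∀ᵐ s : ℝ, s ∈ Ioc t₀ t → ‖g s‖ ≤ L * (η * Real.exp ((L + 1) * (s - t₀))) + δ) :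
    ‖∫ s in t₀..t, g s‖ ≤ η * Real.exp ((L + 1) * (t - t₀)) - η + δ * (t - t₀) := by
  have hd : ∀ s ∈ uIcc t₀ t, HasDerivAt
      (fun s => η * Real.exp ((L + 1) * (s - t₀)) + δ * (s - t₀))
      ((L + 1) * (η * Real.exp ((L + 1) * (s - t₀))) + δ) s := fun s _ => by
    have h1 : HasDerivAt (fun s : ℝ => s - t₀) 1 s := (hasDerivAt_id s).sub_const t₀
    convert! (((h1.const_mul (L + 1)).exp).const_mul η).add (h1.const_mul δ) using 1
    ring
  have hc : Continuous fun s => (L + 1) * (η * Real.exp ((L + 1) * (s - t₀))) + δ := by fun_prop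
  have hi := intervalIntegral.integral_eq_sub_of_hasDerivAt hd (hc.intervalIntegrable _ _)
  have hle := intervalIntegral.norm_integral_le_of_norm_le ht
    (g := fun s => (L + 1) * (η * Real.exp ((L + 1) * (s - t₀))) + δ) (f := g) (by
      filter_upwards [hg] with s hs h
      have : 0 ≤ η * Real.exp ((L + 1) * (s - t₀)) := by positivity
      linarith [hs h]) (hc.intervalIntegrable _ _)
  rw [hi] at hle
  simp only [sub_self, mul_zero, Real.exp_zero, mul_one, add_zero] at hle
  linarith

/-! ### Solutions on compact intervals -/

/-- `x` is a continuous solution of the integral equation on `[t₀, b]`. -/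
def SolvesOn {ℓ n : ℕ} {Δ : ℝ} (τ : Fin (ℓ + 1) → ℝ) (f : RHS ℓ n Δ) (t₀ : ℝ)
    (φ x : ℝ → Fin n → ℝ) (b : ℝ) : Prop :=
  ContinuousOn x (Icc t₀ b) ∧
    ∀ t ∈ Icc t₀ b, x t = φ 0 + ∫ s in t₀..t, rhsAlong τ f t₀ φ φ x s

section Solutions

variable {ℓ n : ℕ} {Δ : ℝ} {τ : Fin (ℓ + 1) → ℝ} {F : Set (RHS ℓ n Δ)} {f : RHS ℓ n Δ}
  {t₀ b : ℝ} {φ x y : ℝ → Fin n → ℝ}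

theorem SolvesOn.mono (h : SolvesOn τ f t₀ φ x b) {b' : ℝ} (hb : b' ≤ b) :
    SolvesOn τ f t₀ φ x b' :=
  ⟨h.1.mono (Icc_subset_Icc_right hb), fun t ht => h.2 t ⟨ht.1, ht.2.trans hb⟩⟩

theorem SolvesOn.apply_left (h : SolvesOn τ f t₀ φ x b) (hb : t₀ ≤ b) : x t₀ = φ 0 := by
  simpa using h.2 t₀ ⟨le_rfl, hb⟩

theorem integral_rhsAlong_congr (hτ : ∀ i, τ i ∈ Icc 0 Δ) {t : ℝ} (ht : t₀ ≤ t)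
    (hφ : MemLp φ ∞ (delayMeasure Δ)) (hx : ContinuousOn x (Icc t₀ t))
    (h : ∀ s ∈ Icc t₀ t, x s = y s) :
    ∫ s in t₀..t, rhsAlong τ f t₀ φ φ x s = ∫ s in t₀..t, rhsAlong τ f t₀ φ φ y s := by
  refine intervalIntegral.integral_congr fun s hs => ?_
  rw [uIcc_of_le ht] at hs
  exact rhsAlong_congr hτ hs.1 hφ (hx.mono (Icc_subset_Icc_right hs.2))
    fun r hr => h r ⟨hr.1, hr.2.trans hs.2⟩

theorem SolvesOn.congr (h : SolvesOn τ f t₀ φ x b) (hτ : ∀ i, τ i ∈ Icc 0 Δ)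
    (hφ : MemLp φ ∞ (delayMeasure Δ)) (hxy : ∀ s ∈ Icc t₀ b, x s = y s) :
    SolvesOn τ f t₀ φ y b := by
  refine ⟨h.1.congr fun s hs => (hxy s hs).symm, fun t ht => ?_⟩
  rw [← hxy t ht, h.2 t ht, integral_rhsAlong_congr hτ ht.1 hφ
    (h.1.mono (Icc_subset_Icc_right ht.2)) fun s hs => hxy s ⟨hs.1, hs.2.trans ht.2⟩]

theorem SolvesOn.norm_sub_le (h : SolvesOn τ f t₀ φ x b) (hτ : ∀ i, τ i ∈ Icc 0 Δ)
    (hF : UniformlyLipschitz τ F) (hf : f ∈ F) (ht₀ : 0 ≤ t₀) (hφ : MemLp φ ∞ (delayMeasure Δ))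
    {K : ℝ} (hK : ∀ᵐ s : ℝ, s ∈ Icc t₀ b → ‖rhsAlong τ f t₀ φ φ x s‖ ≤ K) {s t : ℝ}
    (hs : s ∈ Icc t₀ b) (ht : t ∈ Icc t₀ b) : ‖x t - x s‖ ≤ K * |t - s| := by
  have hi : ∀ r ∈ Icc t₀ b, IntervalIntegrable (rhsAlong τ f t₀ φ φ x) volume t₀ r := fun r hr =>
    intervalIntegrable_rhsAlong hτ hF hf ht₀ hr.1 hφ (h.1.mono (Icc_subset_Icc_right hr.2))
  rw [h.2 t ht, h.2 s hs, add_sub_add_left_eq_sub,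
    intervalIntegral.integral_interval_sub_left (hi t ht) (hi s hs)]
  refine intervalIntegral.norm_integral_le_of_norm_le_const_ae ?_
  filter_upwards [hK] with r hr hrm
  have := uIoc_subset_uIcc hrm
  exact hr (ordConnected_Icc.uIcc_subset hs ht this)

theorem SolvesOn.absolutelyContinuous (h : SolvesOn τ f t₀ φ x b) (hτ : ∀ i, τ i ∈ Icc 0 Δ)
    (hF : UniformlyLipschitz τ F) (hf : f ∈ F) (ht₀ : 0 ≤ t₀) (hb : t₀ ≤ b)
    (hφ : MemLp φ ∞ (delayMeasure Δ)) : AbsolutelyContinuousOnInterval x t₀ b := by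
  obtain ⟨R, hR, hφR, hxR⟩ := exists_common_bound hφ h.1
  -- The horizon must be positive, while `b = t₀ = 0` is allowed; hence `b + 1`.
  obtain ⟨K, L, hK, -, hKL⟩ := exists_rhsAlong_bounds hτ hF hR (T := b + 1) (by linarith)
  have hK' := (hKL f hf t₀ ht₀ b (by linarith) φ φ hφ hφR hφR x h.1 hxR).1
  refine LipschitzOnWith.absolutelyContinuousOnInterval (K := K.toNNReal) ?_
  refine LipschitzOnWith.of_dist_le_mul fun s hs t ht => ?_
  rw [uIcc_of_le hb] at hs ht
  rw [dist_eq_norm, Real.dist_eq, Real.coe_toNNReal _ hK]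
  exact h.norm_sub_le hτ hF hf ht₀ hφ hK' ht hs

theorem isSolution_of_forall_solvesOn {J : Set ℝ} (hτ : ∀ i, τ i ∈ Icc 0 Δ)
    (hF : UniformlyLipschitz τ F) (hf : f ∈ F) (ht₀ : 0 ≤ t₀) (hφ : MemLp φ ∞ (delayMeasure Δ))
    (hJ : ∃ b : EReal, (t₀ : EReal) < b ∧
      (J = {t : ℝ | t₀ ≤ t ∧ (t : EReal) < b} ∨ J = {t : ℝ | t₀ ≤ t ∧ (t : EReal) ≤ b}))
    (h : ∀ t ∈ J, SolvesOn τ f t₀ φ x t) : IsSolution τ f t₀ φ x J := by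
  have hJ0 : ∀ t ∈ J, t₀ ≤ t := by
    obtain ⟨b, -, rfl | rfl⟩ := hJ <;> exact fun t ht => ht.1
  exact ⟨hJ, fun t ht => (h t ht).absolutelyContinuous hτ hF hf ht₀ (hJ0 t ht) hφ,
    fun t ht => intervalIntegrable_rhsAlong hτ hF hf ht₀ (hJ0 t ht) hφ (h t ht).1,
    fun t ht => (h t ht).2 t ⟨hJ0 t ht, le_rfl⟩⟩

theorem IsSolution.left_le {J : Set ℝ} (h : IsSolution τ f t₀ φ x J) {t : ℝ} (ht : t ∈ J) :
    t₀ ≤ t := by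
  obtain ⟨b, -, rfl | rfl⟩ := h.interval <;> exact ht.1

theorem IsSolution.solvesOn {J : Set ℝ} (h : IsSolution τ f t₀ φ x J) {t : ℝ} (ht : t ∈ J) :
    SolvesOn τ f t₀ φ x t := by
  have hsub : ∀ s ∈ Icc t₀ t, s ∈ J := by
    obtain ⟨b, -, rfl | rfl⟩ := h.interval
    · exact fun s hs => ⟨hs.1, (EReal.coe_le_coe_iff.2 hs.2).trans_lt ht.2⟩
    · exact fun s hs => ⟨hs.1, (EReal.coe_le_coe_iff.2 hs.2).trans ht.2⟩
  refine ⟨?_, fun s hs => h.eqn s (hsub s hs)⟩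
  rw [← uIcc_of_le (h.left_le ht)]
  exact (h.absCont t ht).continuousOn

theorem SolvesOn.unique (hx : SolvesOn τ f t₀ φ x b) (hy : SolvesOn τ f t₀ φ y b)
    (hτ : ∀ i, τ i ∈ Icc 0 Δ) (hF : UniformlyLipschitz τ F) (hf : f ∈ F) (ht₀ : 0 ≤ t₀)
    (hb : t₀ ≤ b) (hφ : MemLp φ ∞ (delayMeasure Δ)) : ∀ t ∈ Icc t₀ b, x t = y t := by
  obtain ⟨R₁, hR₁, hφR, hxR⟩ := exists_common_bound hφ hx.1
  obtain ⟨R₂, -, -, hyR⟩ := exists_common_bound hφ hy.1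
  obtain ⟨K, L, -, hL, hKL⟩ := exists_rhsAlong_bounds hτ hF (lt_max_of_lt_left hR₁ : 0 < max R₁ R₂)
    (T := b + 1) (by linarith)
  have hφR' : ∀ᵐ r ∂(delayMeasure Δ), ‖φ r‖ ≤ max R₁ R₂ :=
    hφR.mono fun r hr => hr.trans (le_max_left _ _)
  have hlip := (hKL f hf t₀ ht₀ b (by linarith) φ φ hφ hφR' hφR' x hx.1
    fun s hs => (hxR s hs).trans (le_max_left _ _)).2 y hy.1
    fun s hs => (hyR s hs).trans (le_max_right _ _)
  -- Gronwall with initial error zero: the bound holds for every positive `η`, which is then sent to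
  -- zero.
  have key : ∀ η > 0, ∀ t ∈ Icc t₀ b, ‖x t - y t‖ < η * Real.exp ((L + 1) * (t - t₀)) := by
    intro η hη
    refine forall_norm_lt_of_forall_norm_le (e := fun t => x t - y t) (hx.1.sub hy.1)
      (by fun_prop) (by simpa [hx.apply_left hb, hy.apply_left hb] using hη) fun t ht h => ?_
    have hix := intervalIntegrable_rhsAlong hτ hF hf ht₀ ht.1 hφ
      (hx.1.mono (Icc_subset_Icc_right ht.2))
    have hiy := intervalIntegrable_rhsAlong hτ hF hf ht₀ ht.1 hφ
      (hy.1.mono (Icc_subset_Icc_right ht.2))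
    have := norm_integral_le_exp_sub (L := L) (δ := 0) (η := η) ht.1 hη.le
      (g := fun s => rhsAlong τ f t₀ φ φ x s - rhsAlong τ f t₀ φ φ y s) (by
        filter_upwards [hlip] with s hs hst
        rw [add_zero]
        refine hs ⟨hst.1.le, hst.2.trans ht.2⟩ _ fun r hr => (h r ⟨hr.1, hr.2.trans hst.2⟩).trans ?_
        have := hr.2
        gcongr)
    rw [intervalIntegral.integral_sub hix hiy] at this
    rw [hx.2 t ht, hy.2 t ht, add_sub_add_left_eq_sub]
    linarith
  intro t ht
  refine sub_eq_zero.1 (norm_le_zero_iff.1 (le_of_forall_pos_lt_add fun ε hε => ?_))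
  have := key (ε * Real.exp (-((L + 1) * (t - t₀)))) (by positivity) t ht
  rwa [mul_assoc, ← Real.exp_add, neg_add_cancel, Real.exp_zero, mul_one, ← zero_add ε] at this

/-! ### Continuation and existence of maximal solutions -/

/-- A bounded solution has an essentially bounded right-hand side, hence is Lipschitz and extends
continuously to the endpoint. Both sides of the integral equation are continuous, so it persists
there. -/
theorem exists_solvesOn_of_bounded (hτ : ∀ i, τ i ∈ Icc 0 Δ) (hF : UniformlyLipschitz τ F)
    (hf : f ∈ F) (ht₀ : 0 ≤ t₀) (hb : t₀ < b) (hφ : MemLp φ ∞ (delayMeasure Δ))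
    (hx : ∀ t ∈ Ico t₀ b, SolvesOn τ f t₀ φ x t) {R : ℝ} (hxR : ∀ t ∈ Ico t₀ b, ‖x t‖ ≤ R) :
    ∃ y, SolvesOn τ f t₀ φ y b ∧ ∀ t ∈ Ico t₀ b, y t = x t := by
  obtain ⟨C, hC⟩ := hφ.exists_ae_norm_le
  have hR : 0 < max (max C R) 1 := by positivity
  obtain ⟨K, L, hK, -, hKL⟩ := exists_rhsAlong_bounds hτ hF hR (T := b) (by linarith)
  have hφR : ∀ᵐ r ∂(delayMeasure Δ), ‖φ r‖ ≤ max (max C R) 1 :=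
    hC.mono fun r hr => hr.trans ((le_max_left _ _).trans (le_max_left _ _))
  have hlip : LipschitzOnWith K.toNNReal x (Ico t₀ b) := by
    refine LipschitzOnWith.of_dist_le_mul fun s hs t ht => ?_
    have hm : max s t ∈ Ico t₀ b := ⟨hs.1.trans (le_max_left _ _), max_lt hs.2 ht.2⟩
    rw [dist_eq_norm, Real.dist_eq, Real.coe_toNNReal _ hK]
    refine (hx _ hm).norm_sub_le hτ hF hf ht₀ hφ (hKL f hf t₀ ht₀ _ hm.2.le φ φ hφ hφR hφR x
      (hx _ hm).1 fun r hr => ?_).1 ⟨ht.1, le_max_right _ _⟩ ⟨hs.1, le_max_left _ _⟩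
    exact (hxR r ⟨hr.1, hr.2.trans_lt hm.2⟩).trans ((le_max_right _ _).trans (le_max_left _ _))
  obtain ⟨y, hy, hyx⟩ := hlip.extend_pi
  have hyb : ∀ t ∈ Ico t₀ b, SolvesOn τ f t₀ φ y t := fun t ht =>
    (hx t ht).congr hτ hφ fun s hs => hyx ⟨hs.1, hs.2.trans_lt ht.2⟩
  refine ⟨y, ⟨hy.continuous.continuousOn, ?_⟩, fun t ht => (hyx ht).symm⟩
  have hi := intervalIntegrable_rhsAlong hτ hF hf ht₀ hb.le hφ
    (hy.continuous.continuousOn (s := Icc t₀ b))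
  have hc : ContinuousOn (fun t => φ 0 + ∫ s in t₀..t, rhsAlong τ f t₀ φ φ y s) (Icc t₀ b) := by
    have := intervalIntegral.continuousOn_primitive_interval'
      (a := t₀) (μ := volume) hi left_mem_uIcc
    rw [uIcc_of_le hb.le] at this
    exact continuousOn_const.add this
  have heq : EqOn y (fun t => φ 0 + ∫ s in t₀..t, rhsAlong τ f t₀ φ φ y s) (Ico t₀ b) :=
    fun t ht => (hyb t ht).2 t ⟨ht.1, le_rfl⟩
  exact heq.of_subset_closure hy.continuous.continuousOn hc Ico_subset_Icc_self
    (closure_Ico hb.ne).ge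

/-- Truncation of every coordinate to `[-1, 1]`. -/
noncomputable def truncate {n : ℕ} (v : Fin n → ℝ) : Fin n → ℝ := fun i => max (-1) (min 1 (v i))

theorem norm_truncate_le {n : ℕ} (v : Fin n → ℝ) : ‖truncate v‖ ≤ 1 := by
  refine (pi_norm_le_iff_of_nonneg zero_le_one).2 fun i => ?_
  rw [Real.norm_eq_abs, abs_le]
  exact ⟨le_max_left _ _, max_le (by norm_num) (min_le_left _ _)⟩

theorem truncate_of_norm_le {n : ℕ} {v : Fin n → ℝ} (hv : ‖v‖ ≤ 1) : truncate v = v := by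
  funext i
  have := abs_le.1 ((norm_le_pi_norm v i).trans hv)
  rw [truncate, min_eq_right this.2, max_eq_right this.1]

theorem norm_truncate_sub_le {n : ℕ} (v w : Fin n → ℝ) : ‖truncate v - truncate w‖ ≤ ‖v - w‖ := by
  refine (pi_norm_le_iff_of_nonneg (norm_nonneg _)).2 fun i => le_trans ?_ (norm_le_pi_norm _ i)
  simp only [Pi.sub_apply, truncate, Real.norm_eq_abs]
  have h1 := abs_max_sub_max_le_abs (min 1 (v i)) (min 1 (w i)) (-1)
  have h2 := abs_min_sub_min_le_max 1 (v i) 1 (w i)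
  rw [sub_self, abs_zero, max_eq_right (abs_nonneg _)] at h2
  rw [max_comm (-1), max_comm (-1)]
  exact h1.trans h2

@[fun_prop]
theorem continuous_truncate {n : ℕ} : Continuous (truncate (n := n)) := by
  unfold truncate; fun_prop

/-- Picard iteration for the increment after `b`. Truncating the increment keeps every candidate in
the ball of radius `R + 1`, where one Lipschitz constant is valid, so the contraction acts on a
whole Banach space; at the fixed point the truncation is inactive. -/
theorem SolvesOn.exists_extension (h : SolvesOn τ f t₀ φ x b) (hτ : ∀ i, τ i ∈ Icc 0 Δ)
    (hF : UniformlyLipschitz τ F) (hf : f ∈ F) (ht₀ : 0 ≤ t₀) (hb : t₀ ≤ b)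
    (hφ : MemLp φ ∞ (delayMeasure Δ)) : ∃ δ > 0, ∃ y, SolvesOn τ f t₀ φ y (b + δ) := by
  obtain ⟨R, hR, hφR, hxR⟩ := exists_common_bound hφ h.1
  obtain ⟨K, L, hK, hL, hKL⟩ := exists_rhsAlong_bounds hτ hF (R := R + 1) (by linarith)
    (T := b + 1) (by linarith)
  have hφR' : ∀ᵐ r ∂(delayMeasure Δ), ‖φ r‖ ≤ R + 1 := hφR.mono fun r hr => by linarith
  -- This gives `K * δ ≤ 1`, so the fixed point escapes truncation, and `2 * L * δ ≤ 1 / 2`, the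
  -- contraction constant.
  set δ : ℝ := (K + 4 * L + 1)⁻¹ with hδdef
  have hδ : 0 < δ := by positivity
  have hδeq : δ * (K + 4 * L + 1) = 1 := inv_mul_cancel₀ (by positivity)
  have hLδ : 0 ≤ L * δ := by positivity
  have hKδ : 0 ≤ K * δ := by positivity
  have hδ1 : δ ≤ 1 := by nlinarith
  let p : ℝ → ℝ := fun t => max t₀ (min t b)
  have hp : ∀ t, p t ∈ Icc t₀ b := fun t => ⟨le_max_left _ _, max_le hb (min_le_right _ _)⟩
  have hpc : Continuous p := by fun_prop
  have hxp : Continuous fun t => x (p t) := h.1.comp_continuous hpc hp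
  have hpt : ∀ t ∈ Icc t₀ b, p t = t := fun t ht => by
    simp only [p, min_eq_left ht.2, max_eq_right ht.1]
  -- Subtracting `y b` makes `z y` agree with `x` on `[t₀, b]` for every `y`, not only for those
  -- vanishing at `b`; it costs the factor 2 in `hzl`.
  let z : BoundedContinuousFunction ℝ (Fin n → ℝ) → ℝ → Fin n → ℝ :=
    fun y t => x (p t) + truncate (y (max t b) - y b)
  have hzc : ∀ y, Continuous (z y) := fun y =>
    hxp.add (continuous_truncate.comp (by fun_prop))
  have hzR : ∀ y t, ‖z y t‖ ≤ R + 1 := fun y t =>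
    (norm_add_le _ _).trans (add_le_add (hxR _ (hp t)) (norm_truncate_le _))
  have hzl : ∀ y y' t, ‖z y t - z y' t‖ ≤ 2 * dist y y' := fun y y' t => by
    simp only [z, add_sub_add_left_eq_sub]
    refine (norm_truncate_sub_le _ _).trans ?_
    rw [sub_sub_sub_comm, two_mul]
    refine (_root_.norm_sub_le _ _).trans (add_le_add ?_ ?_) <;>
      · rw [← dist_eq_norm]; exact BoundedContinuousFunction.dist_coe_le_dist _
  have hzi : ∀ y, ∀ t ∈ Icc t₀ (b + δ),
      IntervalIntegrable (rhsAlong τ f t₀ φ φ (z y)) volume t₀ t := fun y t ht =>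
    intervalIntegrable_rhsAlong hτ hF hf ht₀ ht.1 hφ (hzc y).continuousOn
  have hbb : b ∈ Icc t₀ (b + δ) := ⟨hb, by linarith⟩
  -- Clamping the upper limit of integration makes the Picard integral bounded and continuous on the
  -- whole line.
  let q : ℝ → ℝ := fun t => max b (min t (b + δ))
  have hq : ∀ t, q t ∈ Icc b (b + δ) := fun t =>
    ⟨le_max_left _ _, max_le (by linarith) (min_le_right _ _)⟩
  have hqt : ∀ t ∈ Icc b (b + δ), q t = t := fun t ht => by
    simp only [q, min_eq_left ht.2, max_eq_right ht.1]
  have hqI : ∀ t, q t ∈ Icc t₀ (b + δ) := fun t => ⟨hb.trans (hq t).1, (hq t).2⟩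
  have hzib : ∀ y, ∀ t ∈ Icc b (b + δ),
      IntervalIntegrable (rhsAlong τ f t₀ φ φ (z y)) volume b t := fun y t ht =>
    (hzi y b hbb).symm.trans (hzi y t ⟨hb.trans ht.1, ht.2⟩)
  have hsub : ∀ t, ∀ s ∈ uIoc b (q t), s ∈ Icc t₀ (b + δ) := fun t s hs => by
    rw [uIoc_of_le (hq t).1] at hs
    exact ⟨hb.trans hs.1.le, hs.2.trans (hq t).2⟩
  have hqabs : ∀ t, |q t - b| ≤ δ := fun t => by
    rw [abs_of_nonneg (by linarith [(hq t).1])]; linarith [(hq t).2]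
  have hz := fun y => hKL f hf t₀ ht₀ (b + δ) (by linarith) φ φ hφ hφR' hφR' (z y)
    (hzc y).continuousOn fun s _ => hzR y s
  have hΦb : ∀ y t, ‖∫ s in b..q t, rhsAlong τ f t₀ φ φ (z y) s‖ ≤ K * δ := fun y t => by
    refine (intervalIntegral.norm_integral_le_of_norm_le_const_ae (C := K) ?_).trans
      (mul_le_mul_of_nonneg_left (hqabs t) hK)
    filter_upwards [(hz y).1] with s hs hsm
    exact hs (hsub t s hsm)
  have hΦc : ∀ y, Continuous fun t => ∫ s in b..q t, rhsAlong τ f t₀ φ φ (z y) s := fun y => by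
    have := intervalIntegral.continuousOn_primitive_interval' (a := b) (μ := volume)
      (hzib y (b + δ) ⟨by linarith, le_rfl⟩) left_mem_uIcc
    rw [uIcc_of_le (by linarith)] at this
    exact this.comp_continuous (by fun_prop) hq
  let Φ : BoundedContinuousFunction ℝ (Fin n → ℝ) → BoundedContinuousFunction ℝ (Fin n → ℝ) :=
    fun y => BoundedContinuousFunction.ofNormedAddCommGroup _ (hΦc y) (K * δ) (hΦb y)
  have hcontr : ContractingWith (1 / 2) Φ := by
    refine ⟨by norm_num [← NNReal.coe_lt_coe], LipschitzWith.of_dist_le_mul fun y y' => ?_⟩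
    refine (BoundedContinuousFunction.dist_le (by positivity)).2 fun t => ?_
    rw [dist_eq_norm]
    simp only [Φ, BoundedContinuousFunction.coe_ofNormedAddCommGroup]
    rw [← intervalIntegral.integral_sub (hzib y _ (hq t)) (hzib y' _ (hq t))]
    have hle := intervalIntegral.norm_integral_le_of_norm_le_const_ae (a := b) (b := q t)
      (f := fun s => rhsAlong τ f t₀ φ φ (z y) s - rhsAlong τ f t₀ φ φ (z y') s)
      (C := L * (2 * dist y y')) (by
        filter_upwards [(hz y).2 (z y') (hzc y').continuousOn fun s _ => hzR y' s] with s hs hsm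
        exact hs (hsub t s hsm) _ fun r _ => hzl y y' r)
    have hd : 0 ≤ dist y y' := dist_nonneg
    refine (hle.trans (mul_le_mul_of_nonneg_left (hqabs t) (by positivity))).trans ?_
    have : L * δ ≤ 1 / 4 := by nlinarith
    push_cast
    nlinarith
  set y := ContractingWith.fixedPoint Φ hcontr with hy
  have hfix : ∀ t, y t = ∫ s in b..q t, rhsAlong τ f t₀ φ φ (z y) s := fun t => by
    conv_lhs => rw [hy, ← hcontr.fixedPoint_isFixedPt]
    rfl
  have hyb : y b = 0 := by rw [hfix, hqt b ⟨le_rfl, by linarith⟩, intervalIntegral.integral_same]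
  have hy1 : ∀ t, ‖y t‖ ≤ 1 := fun t => by
    rw [hfix]
    exact (hΦb y t).trans (by nlinarith)
  have hzt : ∀ t ∈ Icc t₀ b, x t = z y t := fun t ht => by
    simp only [z, hpt t ht, max_eq_right ht.2, sub_self]
    rw [truncate_of_norm_le (by simp), add_zero]
  refine ⟨δ, hδ, z y, (hzc y).continuousOn, fun t ht => ?_⟩
  rcases le_total t b with htb | htb
  · rw [← hzt t ⟨ht.1, htb⟩, h.2 t ⟨ht.1, htb⟩, integral_rhsAlong_congr hτ ht.1 hφ
      (h.1.mono (Icc_subset_Icc_right htb)) fun s hs => hzt s ⟨hs.1, hs.2.trans htb⟩]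
  · have hpb : p t = b := by simp only [p, min_eq_right htb, max_eq_right hb]
    have h1 : z y t = x b + y t := by
      simp only [z, hpb, max_eq_left htb, hyb, sub_zero]
      rw [truncate_of_norm_le (hy1 t)]
    rw [h1, h.2 b ⟨hb, le_rfl⟩, integral_rhsAlong_congr hτ hb hφ h.1 hzt, hfix,
      hqt t ⟨htb, ht.2⟩, add_assoc,
      intervalIntegral.integral_add_adjacent_intervals (hzi y b hbb) (hzib y t ⟨htb, ht.2⟩)]

theorem solvesOn_refl (hb : b ≤ t₀) : SolvesOn τ f t₀ φ (fun _ => φ 0) b :=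
  ⟨continuousOn_const, fun t ht => by
    obtain rfl : t = t₀ := le_antisymm (ht.2.trans hb) ht.1
    simp⟩

/-- Uniqueness glues the solutions on all compact intervals into one, taken on the diagonal `X s s`.
By local extension the set of reachable endpoints has no greatest element, so the domain is
half-open, and the domain of any other solution consists of reachable endpoints. -/
theorem exists_isMaximalSolution (hτ : ∀ i, τ i ∈ Icc 0 Δ)
    (hF : UniformlyLipschitz τ F) (hf : f ∈ F) (ht₀ : 0 ≤ t₀) (hφ : MemLp φ ∞ (delayMeasure Δ)) :
    ∃ x Tₓ, IsMaximalSolution τ f t₀ φ x Tₓ := by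
  let S : Set ℝ := {b | t₀ ≤ b ∧ ∃ x, SolvesOn τ f t₀ φ x b}
  have hext : ∀ b ∈ S, ∃ c ∈ S, b < c := by
    rintro b ⟨hb, x, hx⟩
    obtain ⟨δ, hδ, y, hy⟩ := hx.exists_extension hτ hF hf ht₀ hb hφ
    exact ⟨b + δ, ⟨by linarith, y, hy⟩, by linarith⟩
  choose! X hX using fun b (hb : b ∈ S) => hb.2
  let Tₓ : EReal := sSup ((fun b : ℝ => (b : EReal)) '' S)
  have hlt : ∀ b ∈ S, (b : EReal) < Tₓ := by
    intro b hb
    obtain ⟨c, hc, hbc⟩ := hext b hb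
    exact (EReal.coe_lt_coe_iff.2 hbc).trans_le (le_sSup (mem_image_of_mem _ hc))
  have hS : ∀ t : ℝ, t₀ ≤ t → (t : EReal) < Tₓ → t ∈ S := by
    intro t ht htT
    obtain ⟨_, ⟨b, hb, rfl⟩, htb⟩ := lt_sSup_iff.1 htT
    exact ⟨ht, X b, (hX b hb).mono (EReal.coe_lt_coe_iff.1 htb).le⟩
  have hsol : ∀ t ∈ S, SolvesOn τ f t₀ φ (fun s => X s s) t := by
    intro t ht
    refine (hX t ht).congr hτ hφ fun s hs => ?_
    have hsS : s ∈ S := ⟨hs.1, X t, (hX t ht).mono hs.2⟩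
    exact ((hX t ht).mono hs.2).unique (hX s hsS) hτ hF hf ht₀ hs.1 hφ s ⟨hs.1, le_rfl⟩
  have hts : t₀ ∈ S := ⟨le_rfl, _, solvesOn_refl le_rfl⟩
  refine ⟨fun s => X s s, Tₓ, isSolution_of_forall_solvesOn hτ hF hf ht₀ hφ
    ⟨Tₓ, hlt t₀ hts, Or.inl rfl⟩ fun t ht => hsol t (hS t ht.1 ht.2), fun y J hy hJ _ => ?_⟩
  refine Subset.antisymm (fun t ht => ⟨hy.left_le ht, hlt t ⟨hy.left_le ht, y, hy.solvesOn ht⟩⟩) hJ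

/-- If the solution stopped at some `Tₓ ≤ T`, boundedness would extend it to the closed interval
`[t₀, Tₓ]`, already a strict extension. -/
theorem IsMaximalSolution.lt_of_forall_norm_le {Tₓ : EReal} {T : ℝ}
    (h : IsMaximalSolution τ f t₀ φ x Tₓ) (hτ : ∀ i, τ i ∈ Icc 0 Δ)
    (hF : UniformlyLipschitz τ F) (hf : f ∈ F) (ht₀ : 0 ≤ t₀) (hφ : MemLp φ ∞ (delayMeasure Δ))
    {R : ℝ} (hR : ∀ t, t₀ ≤ t → t ≤ T → (t : EReal) < Tₓ → ‖x t‖ ≤ R) : (T : EReal) < Tₓ := by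
  have ht₀T : (t₀ : EReal) < Tₓ := by
    obtain ⟨b, hb, hJ | hJ⟩ := h.isSolution.interval
    · have : t₀ ∈ {t : ℝ | t₀ ≤ t ∧ (t : EReal) < Tₓ} := hJ ▸ ⟨le_rfl, hb⟩
      exact this.2
    · have : t₀ ∈ {t : ℝ | t₀ ≤ t ∧ (t : EReal) < Tₓ} := hJ ▸ ⟨le_rfl, hb.le⟩
      exact this.2
  by_contra! hT
  lift Tₓ to ℝ using ⟨ne_top_of_le_ne_top (EReal.coe_ne_top T) hT, ne_bot_of_gt ht₀T⟩
  rw [EReal.coe_le_coe_iff] at hT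
  rw [EReal.coe_lt_coe_iff] at ht₀T
  obtain ⟨y, hy, hyx⟩ := exists_solvesOn_of_bounded hτ hF hf ht₀ ht₀T hφ
    (fun t ht => h.isSolution.solvesOn (t := t) ⟨ht.1, EReal.coe_lt_coe_iff.2 ht.2⟩)
    (fun t ht => hR t ht.1 (ht.2.le.trans hT) (EReal.coe_lt_coe_iff.2 ht.2))
  have hJ := h.maximal y {t : ℝ | t₀ ≤ t ∧ (t : EReal) ≤ Tₓ}
    (isSolution_of_forall_solvesOn hτ hF hf ht₀ hφ
      ⟨Tₓ, EReal.coe_lt_coe_iff.2 ht₀T, Or.inr rfl⟩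
      fun t ht => hy.mono (EReal.coe_le_coe_iff.1 ht.2))
    (fun t ht => ⟨ht.1, ht.2.le⟩)
    (fun t ht => hyx t ⟨ht.1, EReal.coe_lt_coe_iff.1 ht.2⟩)
  have : Tₓ ∈ {t : ℝ | t₀ ≤ t ∧ (t : EReal) < Tₓ} := hJ ▸ ⟨ht₀T.le, le_rfl⟩
  exact this.2.false

end Solutions

/-! ### Weak-* convergence -/

/-- The dot product as a continuous bilinear map. -/
noncomputable def dotProductL (n : ℕ) : (Fin n → ℝ) →L[ℝ] (Fin n → ℝ) →L[ℝ] ℝ :=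
  ∑ i, (ContinuousLinearMap.mul ℝ ℝ).bilinearComp (ContinuousLinearMap.proj i)
    (ContinuousLinearMap.proj i)

@[simp]
theorem dotProductL_apply {n : ℕ} (v w : Fin n → ℝ) : dotProductL n v w = v ⬝ᵥ w := by
  simp [dotProductL, dotProduct]

theorem norm_dotProduct_le {n : ℕ} (v w : Fin n → ℝ) :
    ‖v ⬝ᵥ w‖ ≤ ‖dotProductL n‖ * ‖v‖ * ‖w‖ := by
  simpa using (dotProductL n).le_opNorm₂ v w

theorem MeasureTheory.AEStronglyMeasurable.dotProduct' {n : ℕ} {α : Type*} [MeasurableSpace α]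
    {μ : Measure α} {g h : α → Fin n → ℝ} (hg : AEStronglyMeasurable g μ)
    (hh : AEStronglyMeasurable h μ) : AEStronglyMeasurable (fun a => g a ⬝ᵥ h a) μ := by
  simpa using (dotProductL n).aestronglyMeasurable_comp₂ hg hh

theorem MeasureTheory.Integrable.dotProduct_of_bound {n : ℕ} {α : Type*} [MeasurableSpace α]
    {μ : Measure α} {g h : α → Fin n → ℝ} (hg : Integrable g μ) (hh : AEStronglyMeasurable h μ)
    {C : ℝ} (hC : ∀ᵐ a ∂μ, ‖h a‖ ≤ C) : Integrable (fun a => g a ⬝ᵥ h a) μ := by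
  refine (hg.norm.const_mul (‖dotProductL n‖ * C)).mono'
    (hg.aestronglyMeasurable.dotProduct' hh) ?_
  filter_upwards [hC] with a ha
  calc _ ≤ ‖dotProductL n‖ * ‖g a‖ * ‖h a‖ := norm_dotProduct_le _ _
    _ ≤ ‖dotProductL n‖ * ‖g a‖ * C := by gcongr
    _ = _ := by ring

theorem WeakStarTendsto.comp {Δ : ℝ} {n : ℕ} {φ : ℕ → LInf Δ n} {φ₀ : LInf Δ n}
    (h : WeakStarTendsto φ φ₀) {k : ℕ → ℕ} (hk : Tendsto k atTop atTop) :
    WeakStarTendsto (fun m => φ (k m)) φ₀ :=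
  fun g hg => (h g hg).comp hk

/-- Banach–Steinhaus bounds the functionals on L¹. Testing with indicators times unit vectors bounds
the set averages of each coordinate, hence each coordinate almost everywhere; with the maximum norm
the constant survives. -/
theorem WeakStarTendsto.exists_norm_le {Δ : ℝ} {n : ℕ} {φ : ℕ → LInf Δ n} {φ₀ : LInf Δ n}
    (h : WeakStarTendsto φ φ₀) : ∃ C : ℝ, ∀ k, ‖φ k‖ ≤ C := by
  let Λ : ℕ → Lp (Fin n → ℝ) 1 (delayMeasure Δ) →L[ℝ] ℝ := fun k =>
    ((dotProductL n).lpPairing (delayMeasure Δ) 1 ∞).flip (φ k)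
  have hΛ : ∀ k g, Λ k g = ∫ s, g s ⬝ᵥ φ k s ∂(delayMeasure Δ) := fun k g => by
    simp only [Λ, ContinuousLinearMap.flip_apply, ContinuousLinearMap.lpPairing_eq_integral,
      dotProductL_apply]
  obtain ⟨C, hC⟩ := banach_steinhaus (g := Λ) fun g => by
    obtain ⟨C, hC⟩ := (h g (L1.integrable_coeFn g)).norm.bddAbove_range
    exact ⟨C, fun k => by rw [hΛ]; exact hC ⟨k, rfl⟩⟩
  have hC0 : 0 ≤ C := (norm_nonneg _).trans (hC 0)
  refine ⟨C, fun k => norm_LInf_le hC0 ?_⟩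
  have hint : Integrable (φ k) (delayMeasure Δ) := (Lp.memLp (φ k)).integrable le_top
  have hset : ∀ i (A : Set ℝ), MeasurableSet A →
      |∫ s in A, φ k s i ∂(delayMeasure Δ)| ≤ C * (delayMeasure Δ).real A := by
    intro i A hA
    let g := indicatorConstLp (μ := delayMeasure Δ) 1 hA (measure_ne_top _ _)
      (Pi.single i (1 : ℝ) : Fin n → ℝ)
    have h1 : Λ k g = ∫ s in A, φ k s i ∂(delayMeasure Δ) := by
      rw [hΛ, ← integral_indicator hA]
      refine integral_congr_ae ?_
      filter_upwards [indicatorConstLp_coeFn (p := 1) (hs := hA)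
        (hμs := measure_ne_top (delayMeasure Δ) A)
        (c := (Pi.single i (1 : ℝ) : Fin n → ℝ))] with s hs
      rw [hs]
      by_cases hsA : s ∈ A <;> simp [hsA]
    have h2 : ‖g‖ ≤ (delayMeasure Δ).real A := by
      simp only [g]
      rw [norm_indicatorConstLp one_ne_zero ENNReal.one_ne_top]
      have : ‖(Pi.single i (1 : ℝ) : Fin n → ℝ)‖ ≤ 1 := by
        rw [Pi.norm_single]; simp
      simpa using mul_le_mul_of_nonneg_right this (measureReal_nonneg (μ := delayMeasure Δ))
    rw [← h1, ← Real.norm_eq_abs]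
    exact ((Λ k).le_of_opNorm_le (hC k) g).trans (mul_le_mul_of_nonneg_left h2 hC0)
  have hcoord : ∀ i, ∀ᵐ s ∂(delayMeasure Δ), |φ k s i| ≤ C := by
    intro i
    have hi : Integrable (fun s => φ k s i) (delayMeasure Δ) := hint.eval i
    have h1 := ae_le_of_forall_setIntegral_le hi (integrable_const C) fun A hA _ => by
      rw [setIntegral_const, smul_eq_mul, mul_comm]
      exact (le_abs_self _).trans (hset i A hA)
    have h2 := ae_le_of_forall_setIntegral_le hi.neg (integrable_const C) fun A hA _ => by
      rw [setIntegral_const, smul_eq_mul, mul_comm]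
      simp only [Pi.neg_apply, integral_neg]
      exact (neg_le_abs _).trans (hset i A hA)
    filter_upwards [h1, h2] with s hs1 hs2
    exact abs_le'.2 ⟨hs1, hs2⟩
  filter_upwards [ae_all_iff.2 hcoord] with s hs
  exact (pi_norm_le_iff_of_nonneg hC0).2 hs

/-- Translation acts continuously on L¹; here this is made explicit as convergence of integrals. -/
theorem tendsto_integral_norm_translate_sub {E : Type*} [NormedAddCommGroup E] {G : ℝ → E}
    (hG : Integrable G) {s : ℕ → ℝ} {s₀ : ℝ} (hs : Tendsto s atTop (𝓝 s₀)) :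
    Tendsto (fun m => ∫ u, ‖G (-s m + u) - G (-s₀ + u)‖) atTop (𝓝 0) := by
  have hG1 := memLp_one_iff_integrable.2 hG
  have : Fact ((1 : ℝ≥0∞) ≠ ∞) := ⟨ENNReal.one_ne_top⟩
  have hc : Continuous fun c : ℝ => DomAddAct.mk c +ᵥ hG1.toLp G :=
    (DomAddAct.continuous_mk).vadd continuous_const
  have h1 := ((hc.tendsto (-s₀)).comp hs.neg).sub_const (DomAddAct.mk (-s₀) +ᵥ hG1.toLp G)
  rw [sub_self] at h1
  refine (tendsto_zero_iff_norm_tendsto_zero.1 h1).congr fun m => ?_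
  simp only [Function.comp, DomAddAct.mk_vadd_toLp]
  rw [← MemLp.toLp_sub, L1.norm_eq_integral_norm]
  refine integral_congr_ae ?_
  have h2 : MemLp ((fun u => G (-s m +ᵥ u)) - fun u => G (-s₀ +ᵥ u)) 1 volume :=
    (hG1.comp_measurePreserving (measurePreserving_vadd (-s m) volume)).sub
      (hG1.comp_measurePreserving (measurePreserving_vadd (-s₀) volume))
  filter_upwards [h2.coeFn_toLp] with u hu
  rw [hu]
  rfl

section Translates

variable {Δ t₀ : ℝ} {n : ℕ}

/-- Concatenation, extended by zero to the whole line (it differs from `conc` at `t₀`). -/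
noncomputable def concExtend (Δ t₀ : ℝ) {n : ℕ} (φ x : ℝ → Fin n → ℝ) (u : ℝ) : Fin n → ℝ :=
  (Icc (-Δ) 0).indicator φ (u - t₀) + (Ici t₀).indicator x u

theorem aestronglyMeasurable_indicator_sub {φ : ℝ → Fin n → ℝ}
    (hφ : AEStronglyMeasurable φ (delayMeasure Δ)) (t₀ : ℝ) :
    AEStronglyMeasurable (fun u => (Icc (-Δ) 0).indicator φ (u - t₀)) volume :=
  ((aestronglyMeasurable_indicator_iff measurableSet_Icc).2 hφ).comp_measurePreserving
    (measurePreserving_sub_right volume t₀)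

theorem ae_norm_indicator_sub_le {φ : ℝ → Fin n → ℝ} {R : ℝ} (hR : 0 ≤ R)
    (hφR : ∀ᵐ r ∂(delayMeasure Δ), ‖φ r‖ ≤ R) (t₀ : ℝ) :
    ∀ᵐ u : ℝ, ‖(Icc (-Δ) 0).indicator φ (u - t₀)‖ ≤ R := by
  filter_upwards [ae_shift_of_ae_delayMeasure hφR (-t₀)] with u hu
  rw [← sub_eq_add_neg] at hu
  by_cases h : u - t₀ ∈ Icc (-Δ) 0
  · rw [indicator_of_mem h]; exact hu h
  · rw [indicator_of_notMem h]; simpa using hR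

theorem aestronglyMeasurable_concExtend {φ x : ℝ → Fin n → ℝ}
    (hφ : AEStronglyMeasurable φ (delayMeasure Δ)) (hx : Continuous x) :
    AEStronglyMeasurable (concExtend Δ t₀ φ x) volume :=
  (aestronglyMeasurable_indicator_sub hφ t₀).add
    (hx.aestronglyMeasurable.indicator measurableSet_Ici)

theorem ae_norm_concExtend_le {φ x : ℝ → Fin n → ℝ} {R : ℝ} (hR : 0 ≤ R)
    (hφR : ∀ᵐ r ∂(delayMeasure Δ), ‖φ r‖ ≤ R) (hxR : ∀ t, ‖x t‖ ≤ R) :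
    ∀ᵐ u : ℝ, ‖concExtend Δ t₀ φ x u‖ ≤ R + R := by
  filter_upwards [ae_norm_indicator_sub_le hR hφR t₀] with u hu
  exact (norm_add_le _ _).trans (add_le_add hu ((norm_indicator_le_norm_self _ _).trans (hxR u)))

/-- Changing variables moves the time `s` from the merely bounded concatenation to the integrable
test function, where translation is norm continuous. -/
theorem integral_dotProduct_delaySegment (φ : LInf Δ n) {x : ℝ → Fin n → ℝ} (hx : Continuous x)
    {s : ℝ} (hs : t₀ ≤ s) (g : ℝ → Fin n → ℝ) :
    ∫ r, g r ⬝ᵥ delaySegment Δ (conc t₀ φ x) s r ∂(delayMeasure Δ) =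
      ∫ u, (Icc (-Δ) 0).indicator g (-s + u) ⬝ᵥ concExtend Δ t₀ φ x u := by
  have h1 : ∫ r, g r ⬝ᵥ delaySegment Δ (conc t₀ φ x) s r ∂(delayMeasure Δ) =
      ∫ r in Icc (-Δ) 0, (Icc (-Δ) 0).indicator g r ⬝ᵥ concExtend Δ t₀ φ x (s + r) := by
    refine integral_congr_ae ?_
    -- At this one point `concExtend` adds both the history and `x`.
    have hne : ∀ᵐ r : ℝ, r ≠ t₀ - s := by simp [ae_iff]
    filter_upwards [delaySegment_conc_ae_eq hs (Lp.memLp φ) hx.continuousOn,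
      ae_restrict_of_ae hne, ae_restrict_mem measurableSet_Icc] with r h1 h2 h3
    rw [h1, indicator_of_mem h3, conc, concExtend]
    split_ifs with h
    · have h4 : s + r - t₀ ∈ Icc (-Δ) 0 := ⟨by linarith [h3.1], by linarith⟩
      rw [indicator_of_mem h4, indicator_of_notMem (by simpa using h), add_zero]
    · have h5 : s + r - t₀ ∉ Icc (-Δ) 0 := fun h4 =>
        h2 (by linarith [h4.2, not_lt.1 h])
      rw [indicator_of_notMem h5, indicator_of_mem (by simpa using h), zero_add]
  rw [h1, setIntegral_eq_integral_of_forall_compl_eq_zero fun r hr => by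
    rw [indicator_of_notMem hr, zero_dotProduct]]
  rw [← integral_add_left_eq_self _ (-s)]
  simp

/-- The history part converges by weak-* convergence against a translate of `H`, the part after `t₀`
by dominated convergence. -/
theorem WeakStarTendsto.tendsto_integral_concExtend {φ : ℕ → LInf Δ n} {φ₀ : LInf Δ n}
    (hφ : WeakStarTendsto φ φ₀) {X : ℕ → ℝ → Fin n → ℝ} {Y : ℝ → Fin n → ℝ} {R : ℝ}
    (hX : ∀ m, Continuous (X m)) (hY : Continuous Y) (hXR : ∀ m t, ‖X m t‖ ≤ R)
    (hXY : ∀ t, Tendsto (fun m => X m t) atTop (𝓝 (Y t))) {H : ℝ → Fin n → ℝ}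
    (hH : Integrable H) :
    Tendsto (fun m => ∫ u, H u ⬝ᵥ concExtend Δ t₀ (φ m) (X m) u) atTop
      (𝓝 (∫ u, H u ⬝ᵥ concExtend Δ t₀ φ₀ Y u)) := by
  have hYR : ∀ t, ‖Y t‖ ≤ R := fun t =>
    le_of_tendsto (hXY t).norm (Eventually.of_forall fun m => hXR m t)
  have hR : 0 ≤ R := (norm_nonneg _).trans (hYR 0)
  have hb : ∀ x : ℝ → Fin n → ℝ, (∀ t, ‖x t‖ ≤ R) → ∀ u, ‖(Ici t₀).indicator x u‖ ≤ R :=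
    fun x hx u => (norm_indicator_le_norm_self _ _).trans (hx u)
  have hm : ∀ x : ℝ → Fin n → ℝ, Continuous x →
      AEStronglyMeasurable ((Ici t₀).indicator x) volume := fun x hx =>
    hx.aestronglyMeasurable.indicator measurableSet_Ici
  have hsplit : ∀ (χ : LInf Δ n) (x : ℝ → Fin n → ℝ), Continuous x → (∀ t, ‖x t‖ ≤ R) →
      ∫ u, H u ⬝ᵥ concExtend Δ t₀ χ x u =
        (∫ r, H (r + t₀) ⬝ᵥ χ r ∂(delayMeasure Δ)) + ∫ u, H u ⬝ᵥ (Ici t₀).indicator x u := by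
    intro χ x hx hxR
    simp only [concExtend, dotProduct_add]
    rw [integral_add
      (hH.dotProduct_of_bound (aestronglyMeasurable_indicator_sub (Lp.aestronglyMeasurable χ) t₀)
        (ae_norm_indicator_sub_le (norm_nonneg χ) (LInf_ae_norm_le χ) t₀))
      (hH.dotProduct_of_bound (hm x hx) (Eventually.of_forall (hb x hxR)))]
    congr 1
    rw [← integral_add_right_eq_self _ t₀, ← integral_indicator measurableSet_Icc]
    refine integral_congr_ae (Eventually.of_forall fun r => ?_)
    by_cases hr : r ∈ Icc (-Δ) 0
    · simp only [add_sub_cancel_right, indicator_of_mem hr]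
    · simp only [add_sub_cancel_right, indicator_of_notMem hr, dotProduct_zero]
  simp only [hsplit φ₀ Y hY hYR, fun m => hsplit (φ m) (X m) (hX m) (hXR m)]
  refine (hφ _ (hH.comp_add_right t₀).integrableOn).add ?_
  refine tendsto_integral_of_dominated_convergence (fun u => ‖dotProductL n‖ * ‖H u‖ * R)
    (fun m => hH.aestronglyMeasurable.dotProduct' (hm _ (hX m)))
    ((hH.norm.const_mul _).mul_const _)
    (fun m => Eventually.of_forall fun u => (norm_dotProduct_le _ _).trans ?_)
    (Eventually.of_forall fun u => ?_)
  · have := hb _ (hXR m) u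
    gcongr
  · have h1 : Tendsto (fun m => (Ici t₀).indicator (X m) u) atTop
        (𝓝 ((Ici t₀).indicator Y u)) := by
      by_cases hu : u ∈ Ici t₀
      · simpa only [indicator_of_mem hu] using hXY u
      · simpa only [indicator_of_notMem hu] using tendsto_const_nhds
    simpa only [Function.comp_def, dotProductL_apply] using
      (((dotProductL n) (H u)).continuous.tendsto _).comp h1

/-- Replacing the translate of `g` by `s m` with that by `s₀` costs an L¹ error tending to zero
times a uniform bound; the test function is then fixed. -/
theorem WeakStarTendsto.delaySegment {φ : ℕ → LInf Δ n} {φ₀ : LInf Δ n}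
    (hφ : WeakStarTendsto φ φ₀) {X : ℕ → ℝ → Fin n → ℝ} {Y : ℝ → Fin n → ℝ} {R : ℝ}
    (hφR : ∀ k, ‖φ k‖ ≤ R) (hX : ∀ m, Continuous (X m)) (hY : Continuous Y)
    (hXR : ∀ m t, ‖X m t‖ ≤ R) (hXY : ∀ t, Tendsto (fun m => X m t) atTop (𝓝 (Y t)))
    {s : ℕ → ℝ} {s₀ : ℝ} (hs : Tendsto s atTop (𝓝 s₀)) (hst : ∀ m, t₀ ≤ s m) :
    WeakStarTendsto (fun m => delaySegment Δ (conc t₀ (φ m) (X m)) (s m))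
      (delaySegment Δ (conc t₀ φ₀ Y) s₀) := by
  intro g hg
  have hst₀ : t₀ ≤ s₀ := ge_of_tendsto' hs hst
  have hR : 0 ≤ R := (norm_nonneg _).trans (hφR 0)
  simp only [integral_dotProduct_delaySegment φ₀ hY hst₀,
    fun m => integral_dotProduct_delaySegment (φ m) (hX m) (hst m)]
  set G : ℝ → Fin n → ℝ := (Icc (-Δ) 0).indicator g with hGdef
  have hG : Integrable G := (integrable_indicator_iff measurableSet_Icc).2 hg
  have hGs : ∀ c, Integrable fun u => G (-c + u) := fun c => hG.comp_add_left _
  have hGd : ∀ m, Integrable fun u => G (-s m + u) - G (-s₀ + u) := fun m =>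
    (hGs (s m)).sub (hGs s₀)
  have hbd := fun m => ae_norm_concExtend_le (t₀ := t₀) hR
    ((LInf_ae_norm_le (φ m)).mono fun r hr => hr.trans (hφR m)) (hXR m)
  have hms := fun m => aestronglyMeasurable_concExtend (t₀ := t₀)
    (Lp.aestronglyMeasurable (φ m)) (hX m)
  have h1 := hφ.tendsto_integral_concExtend (t₀ := t₀) hX hY hXR hXY (hGs s₀)
  have h2 : Tendsto (fun m => ∫ u, (G (-s m + u) - G (-s₀ + u)) ⬝ᵥ
      concExtend Δ t₀ (φ m) (X m) u) atTop (𝓝 0) := by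
    have h3 := (tendsto_integral_norm_translate_sub hG hs).const_mul (‖dotProductL n‖ * (R + R))
    rw [mul_zero] at h3
    refine squeeze_zero_norm (fun m => ?_) h3
    rw [← integral_const_mul]
    refine norm_integral_le_of_norm_le ((hGd m).norm.const_mul _) ?_
    filter_upwards [hbd m] with u hu
    calc _ ≤ ‖dotProductL n‖ * ‖G (-s m + u) - G (-s₀ + u)‖ * ‖concExtend Δ t₀ (φ m) (X m) u‖ :=
          norm_dotProduct_le _ _
      _ ≤ ‖dotProductL n‖ * ‖G (-s m + u) - G (-s₀ + u)‖ * (R + R) := by gcongr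
      _ = _ := by ring
  have h4 := h1.add h2
  rw [add_zero] at h4
  refine h4.congr fun m => ?_
  rw [← integral_add ((hGs s₀).dotProduct_of_bound (hms m) (hbd m))
    ((hGd m).dotProduct_of_bound (hms m) (hbd m))]
  refine integral_congr_ae (Eventually.of_forall fun u => ?_)
  simp only [sub_dotProduct]
  ring

end Translates

/-! ### Compactness of families of Lipschitz functions -/

/-- Arzelà–Ascoli on `[a, b]`; since `hp` makes the functions constant on either side, convergence
is uniform on the line. -/
theorem exists_subseq_tendstoUniformly {E : Type*} [NormedAddCommGroup E] [ProperSpace E]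
    {a b : ℝ} (hab : a ≤ b) {X : ℕ → ℝ → E} {K : NNReal} {R : ℝ}
    (hK : ∀ m, LipschitzWith K (X m)) (hR : ∀ m t, ‖X m t‖ ≤ R)
    (hp : ∀ m t, X m (projIcc a b hab t) = X m t) :
    ∃ (Y : ℝ → E) (σ : ℕ → ℕ), StrictMono σ ∧ Continuous Y ∧ (∀ t, ‖Y t‖ ≤ R) ∧
      TendstoUniformly (fun m => X (σ m)) Y atTop := by
  let x : ℕ → BoundedContinuousFunction (Icc a b) E := fun m =>
    BoundedContinuousFunction.mkOfCompact ⟨fun t => X m t, (hK m).continuous.comp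
      continuous_subtype_val⟩
  have hcpt := BoundedContinuousFunction.arzela_ascoli (Metric.closedBall (0 : E) R)
    (isCompact_closedBall 0 R) (range x)
    (by rintro _ t ⟨m, rfl⟩; simpa [x] using hR m t)
    (by
      refine (LipschitzWith.uniformEquicontinuous _ K ?_).equicontinuous
      rintro ⟨_, m, rfl⟩
      have := (hK m).comp (LipschitzWith.subtype_val (Icc a b))
      rwa [mul_one] at this)
  obtain ⟨y, -, σ, hσ, hy⟩ := hcpt.tendsto_subseq fun m => subset_closure (mem_range_self (f := x) m)
  have hu := BoundedContinuousFunction.tendsto_iff_tendstoUniformly.1 hy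
  have hlim : TendstoUniformly (fun m => X (σ m)) (fun t => y (projIcc a b hab t)) atTop := by
    have hx : (fun m => X (σ m)) = fun m => ⇑(x (σ m)) ∘ projIcc a b hab :=
      funext fun m => funext fun t => (hp _ t).symm
    rw [hx]
    exact hu.comp (projIcc a b hab)
  refine ⟨fun t => y (projIcc a b hab t), σ, hσ, y.continuous.comp continuous_projIcc,
    fun t => ?_, hlim⟩
  exact le_of_tendsto (hlim.tendsto_at t).norm (Eventually.of_forall fun m => hR _ _)

/-! ### Uniform convergence along a relatively compact family of functions -/

/-- The functions `X f`, `f ∈ F`, are continuous, bounded by `R`, and form a sequentially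
relatively compact family for uniform convergence. -/
structure RelativelyCompactFamily {ι E : Type*} [NormedAddCommGroup E] (F : Set ι)
    (X : ι → ℝ → E) (R : ℝ) : Prop where
  continuous : ∀ f ∈ F, Continuous (X f)
  norm_le : ∀ f ∈ F, ∀ t, ‖X f t‖ ≤ R
  exists_subseq : ∀ g : ℕ → ι, (∀ m, g m ∈ F) → ∃ (Y : ℝ → E) (σ : ℕ → ℕ), StrictMono σ ∧
    Continuous Y ∧ (∀ t, ‖Y t‖ ≤ R) ∧ TendstoUniformly (fun m => X (g (σ m))) Y atTop

section Family

variable {ℓ n : ℕ} {Δ : ℝ} {τ : Fin (ℓ + 1) → ℝ} {F : Set (RHS ℓ n Δ)}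
  {t₀ T R : ℝ} {X : RHS ℓ n Δ → ℝ → Fin n → ℝ} {φ : ℕ → LInf Δ n} {φ₀ : LInf Δ n}

/-- Along a sequence of counterexamples, pass to limits of the functions and of the times. The
segments with histories `φᵏ` and `φ⁰` then have the same weak-* limit, so (B), applied to each,
contradicts the gap. -/
theorem WeakStarRegular.exists_forall_segment_lt (hF : WeakStarRegular τ F)
    (hX : RelativelyCompactFamily F X R) (ht₀ : 0 ≤ t₀) (hT : t₀ < T) (hR : 0 < R)
    (hφR : ∀ k, ‖φ k‖ ≤ R) (hφ₀R : ‖φ₀‖ ≤ R) (hφ : WeakStarTendsto φ φ₀) {ε : ℝ} (hε : 0 < ε) :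
    ∃ j, ∀ k ≥ j, ∀ f ∈ F, ∀ᵐ s : ℝ, s ∈ Icc t₀ T → ∀ ξ : Fin (ℓ + 1) → Fin n → ℝ, ‖ξ‖ ≤ R →
      ‖f s ξ (delaySegment Δ (conc t₀ (φ k) (X f)) s)
        - f s ξ (delaySegment Δ (conc t₀ φ₀ (X f)) s)‖ < ε := by
  obtain ⟨Z, hZ, hB⟩ := hF.weakStar T (ht₀.trans_lt hT) R hR
  -- Counterexamples must be points outside `Z f`; this works because the null sets in (B) precede
  -- the choice of the sequence.
  suffices ∃ j, ∀ k ≥ j, ∀ f ∈ F, ∀ s ∈ Icc t₀ T, s ∉ Z f → ∀ ξ : Fin (ℓ + 1) → Fin n → ℝ,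
      ‖ξ‖ ≤ R → ‖f s ξ (delaySegment Δ (conc t₀ (φ k) (X f)) s)
        - f s ξ (delaySegment Δ (conc t₀ φ₀ (X f)) s)‖ < ε by
    obtain ⟨j, hj⟩ := this
    refine ⟨j, fun k hk f hf => ?_⟩
    filter_upwards [measure_eq_zero_iff_ae_notMem.1 (hZ f hf)] with s hs hsT
    exact hj k hk f hf s hsT hs
  by_contra! hcon
  choose k hk g hg s hs hsZ ξ hξ hge using hcon
  obtain ⟨Y, σ, hσ, hYc, hYR, hY⟩ := hX.exists_subseq g hg
  obtain ⟨s₀, hs₀, ρ, hρ, hsρ⟩ := isCompact_Icc.tendsto_subseq fun m => hs (σ m)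
  have hμ : Tendsto (fun m => σ (ρ m)) atTop atTop := hσ.tendsto_atTop.comp hρ.tendsto_atTop
  have hkμ : Tendsto (fun m => k (σ (ρ m))) atTop atTop :=
    (tendsto_atTop_mono hk tendsto_id).comp hμ
  have hYt : ∀ t, Tendsto (fun m => X (g (σ (ρ m))) t) atTop (𝓝 (Y t)) := fun t =>
    (hY.tendsto_at t).comp hρ.tendsto_atTop
  have hφ₀c : WeakStarTendsto (fun _ => φ₀) φ₀ := fun _ _ => tendsto_const_nhds
  have hw1 := (hφ.comp hkμ).delaySegment (t₀ := t₀) (fun m => hφR _)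
    (fun m => hX.continuous _ (hg (σ (ρ m)))) hYc
    (fun m t => hX.norm_le _ (hg _) t) hYt hsρ (fun m => (hs _).1)
  have hw2 := hφ₀c.delaySegment (t₀ := t₀) (fun _ => hφ₀R)
    (fun m => hX.continuous _ (hg (σ (ρ m)))) hYc
    (fun m t => hX.norm_le _ (hg _) t) hYt hsρ (fun m => (hs _).1)
  have hn : ∀ (χ : LInf Δ n), ‖χ‖ ≤ R → ∀ m,
      ‖delaySegment Δ (conc t₀ χ (X (g m))) (s m)‖ ≤ R := fun χ hχ m =>
    norm_delaySegment_conc_le (hs m).1 (Lp.memLp χ) (hX.continuous _ (hg m)).continuousOn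
      ((LInf_ae_norm_le χ).mono fun r hr => hr.trans hχ) fun r _ => hX.norm_le _ (hg m) r
  obtain ⟨j₁, hj₁⟩ := hB (ε / 2) (by positivity) _ _ (fun m => hn _ (hφR _) _) hw1
  obtain ⟨j₂, hj₂⟩ := hB (ε / 2) (by positivity) _ _ (fun m => hn _ hφ₀R _) hw2
  -- The index in (B) is uniform in `f`, time and `ξ`, so it may be used at the `m`-th function,
  -- time and vector themselves.
  set m := max j₁ j₂
  have hmem : s (σ (ρ m)) ∈ Icc 0 T \ Z (g (σ (ρ m))) :=
    ⟨⟨ht₀.trans (hs _).1, (hs _).2⟩, hsZ _⟩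
  have h1 := hj₁ _ (hg _) _ hmem _ (hξ (σ (ρ m))) m (le_max_left _ _)
  have h2 := hj₂ _ (hg _) _ hmem _ (hξ (σ (ρ m))) m (le_max_right _ _)
  rw [norm_sub_rev] at h2
  have h3 := (hge (σ (ρ m))).trans (norm_sub_le_norm_sub_add_norm_sub _
    (g (σ (ρ m)) (s (σ (ρ m))) (ξ (σ (ρ m))) (delaySegment Δ (conc t₀ φ₀ Y) s₀)) _)
  linarith

theorem rhsAlong_congr_of_delay_le (hτ : ∀ i, τ i ∈ Icc 0 Δ) {f : RHS ℓ n Δ}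
    {φ ψ χ x : ℝ → Fin n → ℝ} {s : ℝ} (hs : t₀ + Δ ≤ s) :
    rhsAlong τ f t₀ φ χ x s = rhsAlong τ f t₀ ψ χ x s := by
  have : delayed τ (conc t₀ φ x) s = delayed τ (conc t₀ ψ x) s := by
    funext i
    have : ¬ s - τ i < t₀ := by linarith [(hτ i).2]
    simp only [delayed, conc, if_neg this]
  rw [rhsAlong, rhsAlong, this]

/-- The index in (C) depends on the function, so (C) is applied only to a uniform limit `Y` of
would-be counterexamples, and `D` is the integrand along `Y`. Integrability of `D` comes from (C),
as (A) gives no measurability for mixed histories. -/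
theorem WeakStarRegular.exists_forall_integral_lt (hF : WeakStarRegular τ F)
    (hX : RelativelyCompactFamily F X R) (hτ : ∀ i, τ i ∈ Icc 0 Δ) (hΔ : 0 < Δ) (ht₀ : 0 ≤ t₀)
    (hR : 0 < R) (hφR : ∀ k, ‖φ k‖ ≤ R) (hφ₀R : ‖φ₀‖ ≤ R) (hφ : WeakStarTendsto φ φ₀)
    {ε : ℝ} (hε : 0 < ε) :
    ∃ j, ∀ k ≥ j, ∀ f ∈ F, ∃ D : ℝ → Fin n → ℝ, (∀ t ∈ Icc t₀ (t₀ + Δ),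
      IntervalIntegrable D volume t₀ t ∧ ‖∫ s in t₀..t, D s‖ < ε) ∧
      ∀ᵐ s : ℝ, s ∈ Icc t₀ (t₀ + Δ) → ‖rhsAlong τ f t₀ (φ k) φ₀ (X f) s
        - rhsAlong τ f t₀ φ₀ φ₀ (X f) s - D s‖ ≤ ε := by
  obtain ⟨K, L, -, hL, hKL⟩ := exists_rhsAlong_bounds hτ hF.lip hR (T := t₀ + Δ) (by linarith)
  have hae : ∀ χ : LInf Δ n, ‖χ‖ ≤ R → ∀ᵐ r ∂(delayMeasure Δ), ‖χ r‖ ≤ R := fun χ hχ =>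
    (LInf_ae_norm_le χ).mono fun r hr => hr.trans hχ
  by_contra! hcon
  choose k hk g hg hD using hcon
  obtain ⟨Y, σ, hσ, hYc, hYR, hY⟩ := hX.exists_subseq g hg
  obtain ⟨j, hj⟩ := hF.discrete t₀ ht₀ R hR.le Y hYc.continuousOn (fun t _ => hYR t) φ φ₀ hφR hφ
    ε hε
  -- Two Lipschitz errors `L * δ`, one for each history, must fit into `ε`.
  set δ : ℝ := ε / (2 * L + 1) with hδ
  have hδ0 : 0 < δ := by positivity
  have hδε : δ * (2 * L + 1) = ε := div_mul_cancel₀ _ (by positivity)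
  obtain ⟨m, hmj, hm⟩ := ((eventually_ge_atTop j).and
    (Metric.tendstoUniformly_iff.1 hY δ hδ0)).exists
  have hkj : j ≤ k (σ m) := hmj.trans ((hσ.id_le m).trans (hk _))
  refine hD (σ m) (fun s => rhsAlong τ (g (σ m)) t₀ (φ (k (σ m))) φ₀ Y s
    - rhsAlong τ (g (σ m)) t₀ φ₀ φ₀ Y s) (fun t ht => hj t ht _ hkj _ (hg _)) ?_
  have hlip := fun χ hχ => (hKL (g (σ m)) (hg _) t₀ ht₀ (t₀ + Δ) le_rfl χ φ₀ (Lp.memLp φ₀) hχ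
    (hae _ hφ₀R) (X (g (σ m))) (hX.continuous _ (hg _)).continuousOn
    fun s _ => hX.norm_le _ (hg _) s).2 Y hYc.continuousOn fun s _ => hYR s
  filter_upwards [hlip _ (hae _ (hφR (k (σ m)))), hlip _ (hae _ hφ₀R)] with s h1 h2
  rintro ⟨hs, hlt⟩
  have hd : ∀ r ∈ Icc t₀ s, ‖X (g (σ m)) r - Y r‖ ≤ δ := fun r _ => by
    rw [← dist_eq_norm, dist_comm]; exact (hm r).le
  have h3 := h1 hs δ hd
  have h4 := h2 hs δ hd
  rw [sub_sub_sub_comm] at hlt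
  refine hlt.not_ge ((norm_sub_le _ _).trans ?_)
  linarith

/-- Past `c` there is nothing to compensate, so `D₀` is cut off there and its integral freezes. -/
theorem exists_integrable_extension {D₀ G : ℝ → Fin n → ℝ} {c ε : ℝ} (hc : t₀ ≤ c)
    (hD : ∀ t ∈ Icc t₀ c, IntervalIntegrable D₀ volume t₀ t ∧ ‖∫ s in t₀..t, D₀ s‖ < ε)
    (hG : ∀ᵐ s : ℝ, s ∈ Icc t₀ c → ‖G s - D₀ s‖ ≤ ε) (hG0 : ∀ s, c ≤ s → G s = 0) :
    ∃ D : ℝ → Fin n → ℝ, Integrable D ∧ (∀ t ≥ t₀, ‖∫ s in t₀..t, D s‖ < ε) ∧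
      ∀ᵐ s : ℝ, t₀ < s → ‖G s - D s‖ ≤ ε := by
  have hε : 0 < ε := (norm_nonneg _).trans_lt (hD t₀ ⟨le_rfl, hc⟩).2
  refine ⟨(Ioc t₀ c).indicator D₀, ?_, fun t ht => ?_, ?_⟩
  · exact (integrable_indicator_iff measurableSet_Ioc).2
      ((intervalIntegrable_iff_integrableOn_Ioc_of_le hc).1 (hD c ⟨hc, le_rfl⟩).1)
  · rw [intervalIntegral.integral_of_le ht, setIntegral_indicator measurableSet_Ioc,
      Ioc_inter_Ioc, sup_idem, ← intervalIntegral.integral_of_le (le_min ht hc)]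
    exact (hD _ ⟨le_min ht hc, min_le_right _ _⟩).2
  · filter_upwards [hG] with s hs h0
    by_cases hsc : s ≤ c
    · have hsm : s ∈ Ioc t₀ c := ⟨h0, hsc⟩
      rw [indicator_of_mem hsm]
      exact hs ⟨h0.le, hsc⟩
    · rw [indicator_of_notMem (fun h => hsc h.2), hG0 s (not_le.1 hsc).le]
      simpa using hε.le

/-- The history is exchanged first in the segment, then in the delayed values. The latter exchange
has no effect after `t₀ + Δ`, so the estimate from (C) on one delay interval suffices. -/
theorem WeakStarRegular.exists_forall_rhsAlong_decomposition (hF : WeakStarRegular τ F)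
    (hX : RelativelyCompactFamily F X R) (hτ : ∀ i, τ i ∈ Icc 0 Δ) (hΔ : 0 < Δ) (ht₀ : 0 ≤ t₀)
    (hT : t₀ < T) (hR : 0 < R) (hφR : ∀ k, ‖φ k‖ ≤ R) (hφ₀R : ‖φ₀‖ ≤ R)
    (hφ : WeakStarTendsto φ φ₀) {ε : ℝ} (hε : 0 < ε) :
    ∃ j, ∀ k ≥ j, ∀ f ∈ F, ∃ D : ℝ → Fin n → ℝ, Integrable D ∧
      (∀ t ≥ t₀, ‖∫ s in t₀..t, D s‖ ≤ ε) ∧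
      ∀ᵐ s : ℝ, s ∈ Ioc t₀ T → ‖rhsAlong τ f t₀ (φ k) (φ k) (X f) s
        - rhsAlong τ f t₀ φ₀ φ₀ (X f) s - D s‖ ≤ ε := by
  obtain ⟨j₁, hj₁⟩ := hF.exists_forall_segment_lt hX ht₀ hT hR hφR hφ₀R hφ (half_pos hε)
  obtain ⟨j₂, hj₂⟩ := hF.exists_forall_integral_lt hX hτ hΔ ht₀ hR hφR hφ₀R hφ (half_pos hε)
  refine ⟨max j₁ j₂, fun k hk f hf => ?_⟩
  obtain ⟨D₀, hD₀, hD₀G⟩ := hj₂ k (le_of_max_le_right hk) f hf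
  obtain ⟨D, hDi, hD, hDG⟩ := exists_integrable_extension (by linarith) hD₀ hD₀G
    fun s hs => sub_eq_zero.2 (rhsAlong_congr_of_delay_le hτ hs)
  refine ⟨D, hDi, fun t ht => (hD t ht).le.trans (half_le_self hε.le), ?_⟩
  filter_upwards [hDG, hj₁ k (le_of_max_le_left hk) f hf, ae_norm_delayed_conc_le (t := T) hτ
    ((LInf_ae_norm_le (φ k)).mono fun r hr => hr.trans (hφR k))
    fun s _ => hX.norm_le f hf s] with s h1 h2 h3 hs
  have hsI : s ∈ Icc t₀ T := ⟨hs.1.le, hs.2⟩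
  have h4 : ‖rhsAlong τ f t₀ (φ k) (φ k) (X f) s - rhsAlong τ f t₀ (φ k) φ₀ (X f) s‖ < ε / 2 :=
    h2 hsI _ (h3 hsI)
  have h5 := h1 hs.1
  have h6 : rhsAlong τ f t₀ (φ k) (φ k) (X f) s - rhsAlong τ f t₀ φ₀ φ₀ (X f) s - D s =
      (rhsAlong τ f t₀ (φ k) (φ k) (X f) s - rhsAlong τ f t₀ (φ k) φ₀ (X f) s) +
      (rhsAlong τ f t₀ (φ k) φ₀ (X f) s - rhsAlong τ f t₀ φ₀ φ₀ (X f) s - D s) := by abel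
  rw [h6]
  refine (norm_add_le _ _).trans ?_
  linarith

/-! ### Gronwall comparison and compactness of the reference solutions -/

theorem SolvesOn.eqn_of_ae_eq {f : RHS ℓ n Δ} {ψ x : ℝ → Fin n → ℝ} {b : ℝ} {χ : LInf Δ n}
    (h : SolvesOn τ f t₀ ψ x b) (hτ : ∀ i, τ i ∈ Icc 0 Δ) (hψ : ψ =ᵐ[delayMeasure Δ] χ) :
    ∀ t ∈ Icc t₀ b, x t = ψ 0 + ∫ s in t₀..t, rhsAlong τ f t₀ χ χ x s := by
  intro t ht
  rw [h.2 t ht]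
  congr 1
  refine intervalIntegral.integral_congr_ae ?_
  filter_upwards [rhsAlong_congr_history hτ (Lp.memLp χ) hψ h.1] with s hs hst
  rw [uIoc_of_le ht.1] at hst
  exact hs ⟨hst.1.le, hst.2.trans ht.2⟩

/-- A Gronwall estimate for a solution of the equation with initial data near those of `y`. -/
theorem norm_sub_lt_exp_of_decomposition {f : RHS ℓ n Δ} (hF : UniformlyLipschitz τ F)
    (hf : f ∈ F) (hτ : ∀ i, τ i ∈ Icc 0 Δ) (ht₀ : 0 ≤ t₀) {b L η δ : ℝ} (hbT : b ≤ T)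
    {χ χ₀ : LInf Δ n} {x y D : ℝ → Fin n → ℝ} {p p₀ : Fin n → ℝ}
    (hx : ContinuousOn x (Icc t₀ b)) (hy : Continuous y) (hyR : ∀ t, ‖y t‖ + 1 ≤ R)
    (hxe : ∀ t ∈ Icc t₀ b, x t = p + ∫ s in t₀..t, rhsAlong τ f t₀ χ χ x s)
    (hye : ∀ t ∈ Icc t₀ b, y t = p₀ + ∫ s in t₀..t, rhsAlong τ f t₀ χ₀ χ₀ y s)
    (hlip : ∀ t ∈ Icc t₀ b, (∀ s ∈ Icc t₀ t, ‖x s‖ ≤ R) → ∀ᵐ s : ℝ, s ∈ Icc t₀ t → ∀ c,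
      (∀ r ∈ Icc t₀ s, ‖x r - y r‖ ≤ c) →
        ‖rhsAlong τ f t₀ χ χ x s - rhsAlong τ f t₀ χ χ y s‖ ≤ L * c)
    (hD : Integrable D) (hDint : ∀ t ≥ t₀, ‖∫ s in t₀..t, D s‖ ≤ δ)
    (hDr : ∀ᵐ s : ℝ, s ∈ Ioc t₀ T → ‖rhsAlong τ f t₀ χ χ y s - rhsAlong τ f t₀ χ₀ χ₀ y s
      - D s‖ ≤ δ)
    (hp : ‖p - p₀‖ ≤ δ) (hL : 0 ≤ L) (hδ : 0 ≤ δ) (hη : δ * (2 + (T - t₀)) < η)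
    (hη1 : η * Real.exp ((L + 1) * (T - t₀)) ≤ 1) :
    ∀ t ∈ Icc t₀ b, ‖x t - y t‖ < η * Real.exp ((L + 1) * (t - t₀)) := by
  intro t ht
  have hTt₀ : 0 ≤ T - t₀ := by linarith [ht.1, ht.2]
  have hδη : δ < η := by nlinarith
  have hη0 : 0 < η := hδ.trans_lt hδη
  refine forall_norm_lt_of_forall_norm_le (e := fun t => x t - y t)
    (v := fun t => η * Real.exp ((L + 1) * (t - t₀))) (hx.sub hy.continuousOn) (by fun_prop) ?_ (fun t ht h => ?_) t ht
  · have hl : t₀ ∈ Icc t₀ b := ⟨le_rfl, ht.1.trans ht.2⟩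
    simp only [hxe t₀ hl, hye t₀ hl, intervalIntegral.integral_same, add_zero, sub_self, mul_zero,
      Real.exp_zero, mul_one]
    exact hp.trans_lt hδη
  -- The comparison function stays below 1, and `y` leaves that much room in the ball of radius `R`.
  have hxR : ∀ s ∈ Icc t₀ t, ‖x s‖ ≤ R := fun s hs => by
    have h1 := h s hs
    have h2 : η * Real.exp ((L + 1) * (s - t₀)) ≤ η * Real.exp ((L + 1) * (T - t₀)) := by
      have := hs.2.trans (ht.2.trans hbT)
      gcongr
    linarith [norm_le_norm_add_norm_sub' (x s) (y s), hyR s]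
  have hix := intervalIntegrable_rhsAlong hτ hF hf ht₀ ht.1 (Lp.memLp χ)
    (hx.mono (Icc_subset_Icc_right ht.2))
  have hiy := intervalIntegrable_rhsAlong hτ hF hf ht₀ ht.1 (Lp.memLp χ₀)
    (hy.continuousOn (s := Icc t₀ t))
  have hiD : IntervalIntegrable D volume t₀ t := hD.intervalIntegrable
  have key := norm_integral_le_exp_sub (L := L) (δ := δ) (η := η) ht.1 hη0.le
    (g := fun s => rhsAlong τ f t₀ χ χ x s - rhsAlong τ f t₀ χ₀ χ₀ y s - D s) (by
      filter_upwards [hlip t ht hxR, hDr] with s h1 h2 hs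
      have h3 := h1 ⟨hs.1.le, hs.2⟩ (η * Real.exp ((L + 1) * (s - t₀))) fun r hr =>
        (h r ⟨hr.1, hr.2.trans hs.2⟩).trans (by have := hr.2; gcongr)
      have h4 := h2 ⟨hs.1, hs.2.trans (ht.2.trans hbT)⟩
      have h5 : rhsAlong τ f t₀ χ χ x s - rhsAlong τ f t₀ χ₀ χ₀ y s - D s =
        (rhsAlong τ f t₀ χ χ x s - rhsAlong τ f t₀ χ χ y s) +
        (rhsAlong τ f t₀ χ χ y s - rhsAlong τ f t₀ χ₀ χ₀ y s - D s) := by abel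
      rw [h5]
      exact (norm_add_le _ _).trans (add_le_add h3 h4))
  rw [intervalIntegral.integral_sub (hix.sub hiy) hiD, intervalIntegral.integral_sub hix hiy] at key
  have h6 : x t - y t = (p - p₀) + ((∫ s in t₀..t, rhsAlong τ f t₀ χ χ x s) -
      (∫ s in t₀..t, rhsAlong τ f t₀ χ₀ χ₀ y s) - ∫ s in t₀..t, D s) + ∫ s in t₀..t, D s := by
    rw [hxe t ht, hye t ht]; abel
  have h7 : δ * (t - t₀) ≤ δ * (T - t₀) := by
    have := ht.2.trans hbT
    gcongr
  -- The initial error, the integral of `D` and the remainder total at most `δ * (2 + (T - t₀)) <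
  -- η`, which the `-η` in `key` absorbs.
  rw [h6]
  refine (norm_add_le _ _).trans_lt ?_
  have h8 := norm_add_le (p - p₀) ((∫ s in t₀..t, rhsAlong τ f t₀ χ χ x s) -
      (∫ s in t₀..t, rhsAlong τ f t₀ χ₀ χ₀ y s) - ∫ s in t₀..t, D s)
  linarith [hDint t ht.1]

theorem LInf.exists_bounded_representative (φ : LInf Δ n) (ξ : Fin n → ℝ) :
    ∃ ψ : ℝ → Fin n → ℝ, (∃ C : ℝ, ∀ s ∈ Icc (-Δ) 0, ‖ψ s‖ ≤ C) ∧
      ψ =ᵐ[delayMeasure Δ] φ ∧ ψ 0 = ξ := by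
  classical
  refine ⟨fun r => if r = 0 then ξ else if ‖φ r‖ ≤ ‖φ‖ then φ r else 0,
    ⟨max ‖ξ‖ ‖φ‖, fun s _ => ?_⟩, ?_, if_pos rfl⟩
  · dsimp only
    split_ifs with h1 h2
    · exact le_max_left _ _
    · exact h2.trans (le_max_right _ _)
    · simp
  · have hne : ∀ᵐ r : ℝ, r ≠ 0 := by simp [ae_iff]
    filter_upwards [LInf_ae_norm_le φ, ae_restrict_of_ae hne] with r h1 h2
    simp [h1, h2]

/-- A common bound `R` gives a common bound `K` on the right-hand sides, so the solutions, frozen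
outside `[t₀, T]`, are equi-Lipschitz. -/
theorem relativelyCompactFamily_projIcc (hF : UniformlyLipschitz τ F) (hτ : ∀ i, τ i ∈ Icc 0 Δ)
    (ht₀ : 0 ≤ t₀) (hT : t₀ ≤ T) (hT0 : 0 < T) (hR : 0 < R) (hφ₀R : ‖φ₀‖ ≤ R)
    {x : RHS ℓ n Δ → ℝ → Fin n → ℝ} {ψ : RHS ℓ n Δ → ℝ → Fin n → ℝ}
    (hψ : ∀ f ∈ F, ψ f =ᵐ[delayMeasure Δ] φ₀) (hx : ∀ f ∈ F, SolvesOn τ f t₀ (ψ f) (x f) T)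
    (hxR : ∀ f ∈ F, ∀ t ∈ Icc t₀ T, ‖x f t‖ ≤ R) :
    RelativelyCompactFamily F (fun f t => x f (projIcc t₀ T hT t)) R := by
  obtain ⟨K, L, hK, -, hKL⟩ := exists_rhsAlong_bounds hτ hF hR hT0
  have hlip : ∀ f ∈ F, LipschitzWith K.toNNReal fun t => x f (projIcc t₀ T hT t) := by
    intro f hf
    refine LipschitzWith.of_dist_le_mul fun s t => ?_
    have hm : MemLp (ψ f) ∞ (delayMeasure Δ) := (memLp_congr_ae (hψ f hf)).2 (Lp.memLp φ₀)
    have hb : ∀ᵐ r ∂(delayMeasure Δ), ‖ψ f r‖ ≤ R := by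
      filter_upwards [hψ f hf, LInf_ae_norm_le φ₀] with r h1 h2
      exact h1 ▸ h2.trans hφ₀R
    rw [dist_eq_norm, Real.coe_toNNReal _ hK]
    refine ((hx f hf).norm_sub_le hτ hF hf ht₀ hm (hKL f hf t₀ ht₀ T le_rfl _ _ hm hb hb _
      (hx f hf).1 (hxR f hf)).1 (projIcc t₀ T hT t).2 (projIcc t₀ T hT s).2).trans ?_
    refine mul_le_mul_of_nonneg_left ?_ hK
    have := (LipschitzWith.projIcc hT).dist_le_mul s t
    simpa [Subtype.dist_eq, Real.dist_eq] using this
  exact ⟨fun f hf => (hlip f hf).continuous, fun f hf t => hxR f hf _ (projIcc t₀ T hT t).2,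
    fun g hg => exists_subseq_tendstoUniformly hT (X := fun m t => x (g m) (projIcc t₀ T hT t))
      (fun m => hlip _ (hg m)) (fun m t => hxR _ (hg m) _ (projIcc t₀ T hT t).2)
      fun m t => by rw [projIcc_val]⟩

end Family

/-! ### The proposition -/

theorem proposition6 (ℓ n : ℕ) (hℓ : 1 ≤ ℓ) (Δ : ℝ) (τ : Fin (ℓ + 1) → ℝ)
    (hτ_zero : τ 0 = 0) (hτ_mono : StrictMono τ) (hτ_last : τ (Fin.last ℓ) = Δ)
    (F : Set (RHS ℓ n Δ)) (hF : WeakStarRegular τ F)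
    (t₀ : ℝ) (ht₀ : 0 ≤ t₀) (ξ₀ : Fin n → ℝ) (φ₀ : LInf Δ n)
    -- the maximally defined solutions from `(ξ₀, φ₀)` and their existence times
    (x₀ : RHS ℓ n Δ → ℝ → Fin n → ℝ) (T₀ : RHS ℓ n Δ → EReal)
    (hx₀ : ∀ f ∈ F, IsMaximalSolutionFrom τ f t₀ ξ₀ φ₀ (x₀ f) (T₀ f))
    (T : ℝ) (hT : t₀ < T) (hTT₀ : ∀ f ∈ F, (T : EReal) < T₀ f)
    (ξ : ℕ → Fin n → ℝ) (hξ : Tendsto ξ atTop (𝓝 ξ₀))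
    (φ : ℕ → LInf Δ n) (hφ : WeakStarTendsto φ φ₀)
    (hbdd : ∃ Rx : ℝ, ∀ f ∈ F, ∀ t ∈ Icc t₀ T, ‖x₀ f t‖ ≤ Rx) :
    ∀ ε > 0, ∃ j : ℕ, ∀ k ≥ j, ∀ f ∈ F,
      (∃ (x : ℝ → Fin n → ℝ) (Tₓ : EReal), IsMaximalSolutionFrom τ f t₀ (ξ k) (φ k) x Tₓ) ∧
      ∀ (x : ℝ → Fin n → ℝ) (Tₓ : EReal), IsMaximalSolutionFrom τ f t₀ (ξ k) (φ k) x Tₓ →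
        (T : EReal) < Tₓ ∧ ∀ s ∈ Icc t₀ T, ‖x s - x₀ f s‖ ≤ ε := by
  intro ε hε
  have hτ : ∀ i, τ i ∈ Icc 0 Δ := fun i =>
    ⟨hτ_zero ▸ hτ_mono.monotone (Fin.zero_le i), hτ_last ▸ hτ_mono.monotone (Fin.le_last i)⟩
  have hΔ : 0 < Δ := by
    rw [← hτ_zero, ← hτ_last]
    exact hτ_mono (Fin.lt_def.2 (by simp; omega))
  have hT0 : 0 < T := ht₀.trans_lt hT
  have hmem : ∀ (χ : LInf Δ n) (ψ : ℝ → Fin n → ℝ), ψ =ᵐ[delayMeasure Δ] χ →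
      MemLp ψ ∞ (delayMeasure Δ) := fun χ ψ h => (memLp_congr_ae h).2 (Lp.memLp χ)
  obtain ⟨C, hC⟩ := hφ.exists_norm_le
  obtain ⟨Rx, hRx⟩ := hbdd
  choose! ψ₀ hψ₀b hψ₀ hψ₀0 hmax₀ using hx₀
  have hsol₀ : ∀ f ∈ F, SolvesOn τ f t₀ (ψ₀ f) (x₀ f) T := fun f hf =>
    (hmax₀ f hf).isSolution.solvesOn ⟨hT.le, hTT₀ f hf⟩
  set R₁ : ℝ := max (max |C| ‖φ₀‖) |Rx| with hR₁
  -- The extra 1 is room for perturbed solutions around the reference ones.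
  set R : ℝ := R₁ + 1 with hRdef
  have hR₁0 : 0 ≤ R₁ := (abs_nonneg _).trans (le_max_right _ _)
  have hR : 0 < R := by linarith
  have hφR : ∀ k, ‖φ k‖ ≤ R := fun k => by
    linarith [hC k, le_abs_self C, le_max_left |C| ‖φ₀‖, le_max_left (max |C| ‖φ₀‖) |Rx|]
  have hφ₀R : ‖φ₀‖ ≤ R := by
    linarith [le_max_right |C| ‖φ₀‖, le_max_left (max |C| ‖φ₀‖) |Rx|]
  have hxR₁ : ∀ f ∈ F, ∀ t ∈ Icc t₀ T, ‖x₀ f t‖ ≤ R₁ := fun f hf t ht =>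
    (hRx f hf t ht).trans ((le_abs_self _).trans (le_max_right _ _))
  let X : RHS ℓ n Δ → ℝ → Fin n → ℝ := fun f t => x₀ f (projIcc t₀ T hT.le t)
  have hX : RelativelyCompactFamily F X R :=
    relativelyCompactFamily_projIcc hF.lip hτ ht₀ hT.le hT0 hR hφ₀R hψ₀ hsol₀
      fun f hf t ht => (hxR₁ f hf t ht).trans (by linarith)
  have hXx : ∀ f, ∀ t ∈ Icc t₀ T, x₀ f t = X f t := fun f t ht => by
    simp only [X, projIcc_of_mem hT.le ht]
  have hXe : ∀ f ∈ F, ∀ t ∈ Icc t₀ T,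
      X f t = ξ₀ + ∫ s in t₀..t, rhsAlong τ f t₀ φ₀ φ₀ (X f) s := fun f hf t ht => by
    have := ((hsol₀ f hf).congr hτ (hmem _ _ (hψ₀ f hf)) (hXx f)).eqn_of_ae_eq hτ (hψ₀ f hf) t ht
    rwa [hψ₀0 f hf] at this
  obtain ⟨K, L, -, hL, hKL⟩ := exists_rhsAlong_bounds hτ hF.lip hR hT0
  set E : ℝ := Real.exp ((L + 1) * (T - t₀)) with hE
  have hE0 : 0 < E := Real.exp_pos _
  -- The exponential bound then equals `min ε 1` at time `T`: at most `ε` as required, and at most 1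
  -- so that `x` stays in the ball of radius `R`.
  set η : ℝ := min ε 1 / E with hηdef
  have hηE : η * E = min ε 1 := div_mul_cancel₀ _ hE0.ne'
  have hη0 : 0 < η := by positivity
  set δ : ℝ := η / (3 + (T - t₀)) with hδdef
  have hden : 0 < 3 + (T - t₀) := by linarith
  have hδ0 : 0 < δ := by positivity
  have hδη : δ * (2 + (T - t₀)) < η := by
    have : δ * (3 + (T - t₀)) = η := div_mul_cancel₀ _ hden.ne'
    linarith
  obtain ⟨j₁, hj₁⟩ :=
    hF.exists_forall_rhsAlong_decomposition hX hτ hΔ ht₀ hT hR hφR hφ₀R hφ hδ0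
  obtain ⟨j₂, hj₂⟩ := eventually_atTop.1 (Metric.tendsto_nhds.1 hξ δ hδ0)
  refine ⟨max j₁ j₂, fun k hk f hf => ⟨?_, ?_⟩⟩
  · obtain ⟨ψ, hψb, hψ, hψ0⟩ := LInf.exists_bounded_representative (φ k) (ξ k)
    obtain ⟨x, Tₓ, hx⟩ := exists_isMaximalSolution hτ hF.lip hf ht₀ (hmem _ _ hψ)
    exact ⟨x, Tₓ, ψ, hψb, hψ, hψ0, hx⟩
  rintro x Tₓ ⟨ψ, -, hψ, hψ0, hx⟩
  obtain ⟨D, hD, hDint, hDr⟩ := hj₁ k (le_of_max_le_left hk) f hf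
  have hp : ‖ξ k - ξ₀‖ ≤ δ := by
    rw [← dist_eq_norm]; exact (hj₂ k (le_of_max_le_right hk)).le
  have hae : ∀ᵐ r ∂(delayMeasure Δ), ‖φ k r‖ ≤ R :=
    (LInf_ae_norm_le (φ k)).mono fun r hr => hr.trans (hφR k)
  -- Proved only for times at which `x` exists; the bound it gives then forces existence beyond `T`.
  have hest : ∀ b, t₀ ≤ b → b ≤ T → (b : EReal) < Tₓ → ‖x b - x₀ f b‖ < min ε 1 := by
    intro b hb hbT hbx
    have hs := hx.isSolution.solvesOn (t := b) ⟨hb, hbx⟩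
    have hlt := norm_sub_lt_exp_of_decomposition (R := R) (δ := δ) (η := η) hF.lip hf hτ ht₀ hbT
      hs.1 (hX.continuous f hf)
      (fun t => by linarith [hxR₁ f hf _ (projIcc t₀ T hT.le t).2])
      (fun t ht => by rw [← hψ0]; exact hs.eqn_of_ae_eq hτ hψ t ht)
      (fun t ht => hXe f hf t ⟨ht.1, ht.2.trans hbT⟩)
      (fun t ht hxR => (hKL f hf t₀ ht₀ t (ht.2.trans hbT) (φ k) (φ k) (Lp.memLp _) hae hae x
        (hs.1.mono (Icc_subset_Icc_right ht.2)) hxR).2 (X f) (hX.continuous f hf).continuousOn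
        fun s _ => hX.norm_le f hf s)
      hD hDint hDr hp hL hδ0.le hδη (hηE.trans_le (min_le_right _ _)) b ⟨hb, le_rfl⟩
    rw [← hXx f b ⟨hb, hbT⟩] at hlt
    refine hlt.trans_le (le_trans ?_ hηE.le)
    exact mul_le_mul_of_nonneg_left (Real.exp_le_exp.2 (by gcongr)) hη0.le
  have hTx : (T : EReal) < Tₓ := by
    refine hx.lt_of_forall_norm_le hτ hF.lip hf ht₀ (hmem _ _ hψ) (R := R) fun t h1 h2 h3 => ?_
    linarith [hest t h1 h2 h3, min_le_right ε 1, hxR₁ f hf t ⟨h1, h2⟩,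
      norm_le_norm_add_norm_sub' (x t) (x₀ f t)]
  refine ⟨hTx, fun s hs => ?_⟩
  exact ((hest s hs.1 hs.2 ((EReal.coe_le_coe_iff.2 hs.2).trans_lt hTx)).trans_le
    (min_le_left _ _)).le
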